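/- Let $(M,g)$ be a complete connected Riemannian manifold without boundary of dimension $n\ge 2$, with distance $d_g$, and let $\omega=e^{-f}\mathrm{vol}_g$ with $f\in C^\infty(M)$. Let $\varphi:(0,\infty)\to(0,\infty)$ be non-decreasing and continuous. Put $$\ln_\varphi(t)=\int_1^t\frac{ds}{\varphi(s)},\qquad l_\varphi=\inf_{t>0}\ln_\varphi(t),\qquad L_\varphi=\sup_{t>0}\ln_\varphi(t),\qquad u_\varphi(r)=\int_0^r\ln_\varphi(t)\,dt,$$ let $\exp_\varphi(\tau)$ be $0$ for $\tau\le l_\varphi$, $\ln_\varphi^{-1}(\tau)$ for $l_\varphi<\tau<L_\varphi$ and $\infty$ for $\tau\ge L_\varphi$, and let $\theta_\varphi$ and $\delta_\varphi$ be the supremum and the infimum over $s>0$ of $\frac{s}{\varphi(s)}\limsup_{t\downarrow 0}\frac{\varphi(s+t)-\varphi(s)}{t}$. Put $h_\varphi(r)=u_\varphi(r)$, $h_\varphi'(\infty)=\infty$ if $L_\varphi=\infty$, and $h_\varphi(r)=u_\varphi(r)-rL_\varphi$, $h_\varphi'(\infty)=0$ if $L_\varphi<\infty$. Let $\Psi\in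 C(M)$, $\sigma=\exp_\varphi(-\Psi)$, $\nu=\sigma\omega$ and $M_\varphi^\Psi=\Psi^{-1}((-L_\varphi,-l_\varphi))$. Assume that $(M,\omega,\varphi,\Psi)$ is admissible, that is: $\varphi(1)=1$; $\theta_\varphi\le (n+1)/n$ and $\theta_\varphi<3/2$; $\Psi>-L$ on $M$, where $L=\sup_{t>0}\int_1^t s^{-\theta_\varphi}\,ds$, and $M_\varphi^\Psi\ne\emptyset$; and $h_\varphi(\sigma)$ and $\sigma\ln_\varphi(\sigma)$ belong to $L^1(M,\omega)$ (with $0\ln_\varphi(0)=0$). For a Borel probability measure $\mu$ on $M$ with Lebesgue decomposition $\mu=\rho\omega+\mu^s$, let $$H_\varphi(\mu)=\int_M h_\varphi(\rho)\,d\omega-\int_M h_\varphi'(\sigma)\,d\mu+h_\varphi'(\infty)\,\mu^s[M]$$ if $h_\varphi(\rho)\in L^1(M,\omega)$ and $h_\varphi'(\sigma)\in L^1(M,\mu)$, and $H_\varphi(\mu)=\infty$ otherwise (where $\infty\cdot 0=0$, and $\ln_\varphi(0):=l_\varphi$ in $h'_\varphi(\sigma)$ on $\{\sigma=0\}$). Assume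 moreover that $\nu[M]=1$, that $\|\sigma\|_\infty=\|\sigma\|_{L^\infty(M,\omega)}<\infty$, and that $\operatorname{Hess}H_\varphi\ge K$ for some $K>0$ in the following sense: with $(\mathcal P^2(M),W_2)$ the quadratic Wasserstein space over $(M,d_g)$, any $\mu_0,\mu_1\in\mathcal P^2(M)$ with $\mu_0[M_\varphi^\Psi]=\mu_1[M_\varphi^\Psi]=1$ can be joined by a minimal geodesic $(\mu_t)_{t\in[0,1]}$ of $(\mathcal P^2(M),W_2)$ such that, for all $t\in[0,1]$, $$H_\varphi(\mu_t)\le(1-t)H_\varphi(\mu_0)+tH_\varphi(\mu_1)-\frac K2(1-t)t\,W_2(\mu_0,\mu_1)^2 .$$ For $r>0$ let $\alpha(r)=\sup\{1-\nu[B(A,r)] : A\subset M \text{ measurable},\ \nu[A]\ge 1/2\}$, where $B(A,r)=\{y\in M : \inf_{x\in A}d_g(x,y)<r\}$. Then $H_\nu:=H_\varphi(\nu)$ is finite and $H_\nu\le 0$, and for any $\xi_0\ge\max\{1/2,\|\sigma\|_\infty\}$ and any $r>0$ with $\alpha(r)>0$ we have $$\alpha(r)^{\delta_\varphi-2}\,\ln_\varphi(\alpha(r))\;\xi_0^{\theta_\varphi-\delta_\varphi}\cdot\sup_A\int_{M\setminus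 B(A,r)}\sigma^{2-\theta_\varphi}\,d\omega\;\le\;-\Big(\sqrt{\tfrac K2}\,r-\sqrt{-H_\nu}\Big)^2-H_\nu,$$ where $A$ runs over all measurable subsets of $M$ with $\nu[A]\ge 1/2$. (If the supremum is infinite, the product is taken in $[-\infty,\infty]$.) -/

import Mathlib

open Set Filter Topology MeasureTheory Manifold Bundle
open scoped ENNReal ContDiff

noncomputable section

namespace PhiEntropy

/-! ### Information geometry of a function `φ : (0,∞) → (0,∞)`

Only the values of `φ` on `(0,∞)` are used. -/

/-- `φ` is a non-decreasing, positive, continuous function on `(0,∞)`. -/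
structure IsWeightFunction (φ : ℝ → ℝ) : Prop where
  pos : ∀ s, 0 < s → 0 < φ s
  mono : MonotoneOn φ (Ioi 0)
  cont : ContinuousOn φ (Ioi 0)

/-- The `φ`-logarithm `ln_φ(t) = ∫_1^t ds / φ(s)`, for `t > 0`. -/
def lnPhi (φ : ℝ → ℝ) (t : ℝ) : ℝ := ∫ s in (1 : ℝ)..t, (φ s)⁻¹

/-- `l_φ = inf_{t > 0} ln_φ(t)`, an element of `[-∞, 0)`. -/
def lowerLog (φ : ℝ → ℝ) : EReal := ⨅ t : ℝ, ⨅ _ : 0 < t, (lnPhi φ t : EReal)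

/-- `L_φ = sup_{t > 0} ln_φ(t)`, an element of `(0, ∞]`. -/
def upperLog (φ : ℝ → ℝ) : EReal := ⨆ t : ℝ, ⨆ _ : 0 < t, (lnPhi φ t : EReal)

open Classical in
/-- The `φ`-exponential: `0` for `τ ≤ l_φ`, the inverse of `ln_φ : (0,∞) → (l_φ, L_φ)` for
`l_φ < τ < L_φ`, and `∞` for `τ ≥ L_φ`. -/
def expPhi (φ : ℝ → ℝ) (τ : ℝ) : ℝ≥0∞ :=
  if (τ : EReal) ≤ lowerLog φ then 0
  else if upperLog φ ≤ (τ : EReal) then ⊤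
  else ENNReal.ofReal (Function.invFunOn (lnPhi φ) (Ioi 0) τ)

/-- `u_φ(r) = ∫_0^r ln_φ(t) dt`, for `r ≥ 0`. -/
def uPhi (φ : ℝ → ℝ) (r : ℝ) : ℝ := ∫ t in (0 : ℝ)..r, lnPhi φ t

/-- `(s / φ(s)) · limsup_{t ↓ 0} (φ(s+t) - φ(s)) / t`, an element of `[0, ∞]`
(the difference quotients are nonnegative as `φ` is non-decreasing). -/
def logSlope (φ : ℝ → ℝ) (s : ℝ) : ℝ≥0∞ :=
  ENNReal.ofReal (s / φ s) *
    limsup (fun t : ℝ => ENNReal.ofReal ((φ (s + t) - φ s) / t)) (𝓝[>] 0)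

/-- `θ_φ`, the supremum of the logarithmic slopes. -/
def theta (φ : ℝ → ℝ) : ℝ≥0∞ := ⨆ s : ℝ, ⨆ _ : 0 < s, logSlope φ s

/-- `δ_φ`, the infimum of the logarithmic slopes. -/
def delta (φ : ℝ → ℝ) : ℝ≥0∞ := ⨅ s : ℝ, ⨅ _ : 0 < s, logSlope φ s

open Classical in
/-- `h_φ(r) = u_φ(r)` if `L_φ = ∞`, and `h_φ(r) = u_φ(r) - r L_φ` if `L_φ < ∞`. -/
def hPhi (φ : ℝ → ℝ) (r : ℝ) : ℝ :=
  if upperLog φ = ⊤ then uPhi φ r else uPhi φ r - r * (upperLog φ).toReal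

open Classical in
/-- `h_φ'(r)` for `r ≥ 0`: it is `ln_φ(r)` if `L_φ = ∞` and `ln_φ(r) - L_φ` if `L_φ < ∞`,
where the value of `ln_φ` at `r = 0` is `l_φ` (used only when `l_φ > -∞`). -/
def hPhiDeriv (φ : ℝ → ℝ) (r : ℝ) : ℝ :=
  (if 0 < r then lnPhi φ r else (lowerLog φ).toReal) -
    (if upperLog φ = ⊤ then 0 else (upperLog φ).toReal)

open Classical in
/-- `h_φ'(∞) = ∞` if `L_φ = ∞`, and `0` if `L_φ < ∞`. -/
def hPhiDerivTop (φ : ℝ → ℝ) : EReal := if upperLog φ = ⊤ then ⊤ else 0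

/-! ### The Riemannian volume measure -/

section Riemannian

variable (n : ℕ) (M : Type*) [MetricSpace M] [ChartedSpace (EuclideanSpace ℝ (Fin n)) M]

theorem exists_chart_cover [SecondCountableTopology M] [Nonempty M] :
    ∃ c : ℕ → M, ⋃ k, (chartAt (EuclideanSpace ℝ (Fin n)) (c k)).source = univ := by
  obtain ⟨t, htc, htU⟩ := TopologicalSpace.countable_cover_nhds
    (fun x : M => chart_source_mem_nhds (EuclideanSpace ℝ (Fin n)) x)
  have hne : t.Nonempty := by
    by_contra h
    rw [Set.not_nonempty_iff_eq_empty] at h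
    subst h
    obtain ⟨x⟩ := ‹Nonempty M›
    have : x ∈ (univ : Set M) := mem_univ x
    rw [← htU] at this
    simp at this
  obtain ⟨c, rfl⟩ := htc.exists_eq_range hne
  exact ⟨c, by simpa using htU⟩

/-- A sequence of centres of charts of `M` whose domains cover `M`. -/
def chartCenter [SecondCountableTopology M] [Nonempty M] : ℕ → M :=
  (exists_chart_cover n M).choose

section Volume

variable [RiemannianBundle (fun x : M => TangentSpace (𝓡 n) x)]

variable {M} in
/-- The `i`-th coordinate vector field of the chart around `c`, at the point with
coordinates `y`. -/
def coordVec (c : M) (y : EuclideanSpace ℝ (Fin n)) (i : Fin n) :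
    TangentSpace (𝓡 n) ((extChartAt (𝓡 n) c).symm y) :=
  mfderiv (𝓡 n) (𝓡 n) (extChartAt (𝓡 n) c).symm y
    (EuclideanSpace.single i (1 : ℝ) : EuclideanSpace ℝ (Fin n))

variable {M} in
/-- The matrix `(g_{ij})` of the metric in the chart around `c`, at the point with
coordinates `y`. -/
def gramMatrix (c : M) (y : EuclideanSpace ℝ (Fin n)) : Matrix (Fin n) (Fin n) ℝ :=
  Matrix.of fun i j => inner ℝ (coordVec n c y i) (coordVec n c y j)

variable {M} in
/-- The Riemannian volume on the domain of the chart around `c` (extended by zero):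
`√(det g_{ij}) dy` on the range of the chart, carried to `M` by the inverse of the chart. -/
def chartVolume [MeasurableSpace M] (c : M) : Measure M :=
  (((volume : Measure (EuclideanSpace ℝ (Fin n))).restrict (extChartAt (𝓡 n) c).target).withDensity
    (fun y => ENNReal.ofReal (Real.sqrt (gramMatrix n c y).det))).map (extChartAt (𝓡 n) c).symm

/-- The Riemannian volume measure `vol_g` of `M`: the domains of a countable family of charts are
made disjoint, and the volumes on the resulting pieces are added up. By the change of variables
formula the result does not depend on the family of charts. -/
def riemannianVolume [SecondCountableTopology M] [Nonempty M] [MeasurableSpace M] : Measure M :=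
  Measure.sum fun k => (chartVolume n (chartCenter n M k)).restrict
    (disjointed (fun j => (chartAt (EuclideanSpace ℝ (Fin n)) (chartCenter n M j)).source) k)

/-- The weighted measure `ω = e^{-f} vol_g`. -/
def weightedVolume [SecondCountableTopology M] [Nonempty M] [MeasurableSpace M] (f : M → ℝ) :
    Measure M :=
  (riemannianVolume n M).withDensity fun x => ENNReal.ofReal (Real.exp (-f x))

end Volume

end Riemannian

/-! ### The quadratic Wasserstein space -/

section Wasserstein

variable {X : Type*} [MetricSpace X] [MeasurableSpace X]

/-- `μ ∈ P²(X)`: `μ` is a probability measure of finite second moment. -/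
def MemP2 (μ : Measure X) : Prop :=
  IsProbabilityMeasure μ ∧ ∃ x₀ : X, ∫⁻ x, edist x₀ x ^ 2 ∂μ < ⊤

/-- `γ` is a coupling of `μ` and `ν`. -/
def IsCoupling (γ : Measure (X × X)) (μ ν : Measure X) : Prop :=
  γ.map Prod.fst = μ ∧ γ.map Prod.snd = ν

/-- The `L²`-Wasserstein distance between `μ, ν ∈ P²(X)`. -/
def W2 (μ ν : Measure X) : ℝ :=
  (⨅ γ : Measure (X × X), ⨅ _ : IsCoupling γ μ ν,
    (∫⁻ z, edist z.1 z.2 ^ 2 ∂γ) ^ (1 / 2 : ℝ)).toReal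

/-- `(μ_t)_{t ∈ [0,1]}` is a minimal geodesic of `(P²(X), W₂)` from `μ₀` to `μ₁`. -/
structure IsMinimalGeodesic (μ : ℝ → Measure X) (μ₀ μ₁ : Measure X) : Prop where
  mem : ∀ t ∈ Icc (0 : ℝ) 1, MemP2 (μ t)
  start : μ 0 = μ₀
  finish : μ 1 = μ₁
  dist_eq : ∀ s ∈ Icc (0 : ℝ) 1, ∀ t ∈ Icc (0 : ℝ) 1, W2 (μ s) (μ t) = |s - t| * W2 μ₀ μ₁

/-- Displacement `K`-convexity of a functional `S`, tested on pairs of measures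
in `P²(X)` that are concentrated on the set `Y`. -/
def DisplacementConvexOn (S : Measure X → EReal) (Y : Set X) (K : ℝ) : Prop :=
  ∀ μ₀ μ₁ : Measure X, MemP2 μ₀ → MemP2 μ₁ → μ₀ Yᶜ = 0 → μ₁ Yᶜ = 0 →
    ∃ μ : ℝ → Measure X, IsMinimalGeodesic μ μ₀ μ₁ ∧
      ∀ t ∈ Icc (0 : ℝ) 1,
        S (μ t) ≤ ((1 - t : ℝ) : EReal) * S μ₀ + (t : EReal) * S μ₁
          - ((K / 2 * (1 - t) * t * W2 μ₀ μ₁ ^ 2 : ℝ) : EReal)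

/-- The concentration function
`α(r) = sup { 1 - ν[B(A,r)] : A measurable, ν[A] ≥ 1/2 }` of a probability measure `ν`, where
`B(A,r)` is the set of points at distance less than `r` from `A`. -/
def concentration (ν : Measure X) (r : ℝ) : ℝ :=
  sSup {a : ℝ | ∃ A : Set X, MeasurableSet A ∧ 1 / 2 ≤ ν.real A ∧
    a = 1 - ν.real (Metric.thickening r A)}

end Wasserstein

/-! ### The reference measure, admissibility and the `φ`-relative entropy -/

section Entropy

variable {M : Type*} [MeasurableSpace M]

/-- The density `σ = exp_φ(-Ψ)`, which is finite where `Ψ > -L_φ`. -/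
def refDensity (φ : ℝ → ℝ) (Ψ : M → ℝ) (x : M) : ℝ := (expPhi φ (-Ψ x)).toReal

/-- The reference measure `ν = exp_φ(-Ψ) ω`. -/
def refMeasure (ωM : Measure M) (φ : ℝ → ℝ) (Ψ : M → ℝ) : Measure M :=
  ωM.withDensity fun x => expPhi φ (-Ψ x)

/-- The set `M_φ^Ψ = Ψ⁻¹((-L_φ, -l_φ))`. -/
def positivitySet (φ : ℝ → ℝ) (Ψ : M → ℝ) : Set M :=
  {x | -upperLog φ < (Ψ x : EReal) ∧ (Ψ x : EReal) < -lowerLog φ}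

/-- Admissibility of `(M, ω, φ, Ψ)`, where `n = dim M`. With `m = 2 - θ_φ`, the number
`L_m` is `L_φ` for the function `s ↦ s ^ (2 - m) = s ^ θ_φ`. -/
structure Admissible (n : ℕ) (ωM : Measure M) (φ : ℝ → ℝ) (Ψ : M → ℝ) : Prop where
  normalized : φ 1 = 1
  theta_le : theta φ ≤ ENNReal.ofReal ((n + 1) / n)
  theta_lt : theta φ < ENNReal.ofReal (3 / 2)
  potential_gt : ∀ x, -upperLog (fun s : ℝ => s ^ (theta φ).toReal) < (Ψ x : EReal)
  nonempty : (positivitySet φ Ψ).Nonempty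
  integrable_h : Integrable (fun x => hPhi φ (refDensity φ Ψ x)) ωM
  integrable_ln : Integrable (fun x => refDensity φ Ψ x * lnPhi φ (refDensity φ Ψ x)) ωM

open Classical in
/-- The `φ`-relative entropy of a probability measure `μ` with Lebesgue decomposition
`μ = ρ ω + μ^s`: it is `∫ h_φ(ρ) dω - ∫ h_φ'(σ) dμ + h_φ'(∞) μ^s[M]` (with `∞ · 0 = 0`) if
`h_φ(ρ) ∈ L¹(ω)` and `h_φ'(σ) ∈ L¹(μ)`, and `∞` otherwise. -/
def relEntropy (ωM : Measure M) (φ : ℝ → ℝ) (Ψ : M → ℝ) (μ : Measure M) : EReal :=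
  if Integrable (fun x => hPhi φ (μ.rnDeriv ωM x).toReal) ωM ∧
      Integrable (fun x => hPhiDeriv φ (refDensity φ Ψ x)) μ then
    ((∫ x, hPhi φ (μ.rnDeriv ωM x).toReal ∂ωM - ∫ x, hPhiDeriv φ (refDensity φ Ψ x) ∂μ : ℝ) : EReal)
      + hPhiDerivTop φ * ((μ.singularPart ωM univ : ℝ≥0∞) : EReal)
  else ⊤

end Entropy

end PhiEntropy

end

namespace PhiEntropy

/-! Write ν_C for the normalized restriction of ν to C and c = ν[C]. Its density is σ/c on C, and
the terms in L_φ cancel, so its entropy is the integral over C of u_φ(σ/c) - (σ/c) ln_φ(σ)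
(`relEntropy_cond`). Convexity of h_φ makes ν a minimizer (`relEntropy_refMeasure_le`), and Hν ≤ 0.

Let A have mass at least 1/2, let B be the complement of its r-neighbourhood, and take a geodesic
from ν_A to ν_B. Since W₂(ν_A, ν_B) ≥ r and the entropy along the geodesic is at least Hν,
K-convexity gives (K/2) t(1-t) r² ≤ (1-t)(H(ν_A) - Hν) + t(H(ν_B) - Hν). The best t yields √(K/2) r
≤ √(H(ν_A) - Hν) + √(H(ν_B) - Hν) (`sqrt_mul_le_sqrt_add_sqrt`).

Two bounds finish the argument. Concavity of ln_φ gives H(ν_A) ≤ 0, and this is where mass 1/2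
enters (`uPhi_mul_le`). Integrating the logarithmic slopes gives c^δ φ(τ) ≤ φ(cτ) for c ≥ 1 and c^θ
φ(τ) ≤ φ(cτ) for c ≤ 1. Rescaling the integral that defines ln_φ then bounds H(ν_B), with b = ν[B],
by -b^(δ-2) ln_φ(b) ξ₀^(θ-δ) ∫_B σ^(2-θ) dω (`uPhi_div_sub_le`).

The sets A and B need not be bounded, so the transport argument is run inside balls and the radius
is sent to infinity. A second limit, along sets whose values of ν[B] tend to α(r), replaces ν[B] by
α(r). -/

theorem hasDerivAt_const_mul_div_rpow {a x : ℝ} (ha : 0 < a) (hx : 0 < x) (c p : ℝ) :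
    HasDerivAt (fun y : ℝ => c * (y / a) ^ p) (p * (c * (x / a) ^ p) / x) x := by
  have hxa : 0 < x / a := div_pos hx ha
  have h := (((hasDerivAt_id x).div_const a).rpow_const (p := p) (Or.inl hxa.ne')).const_mul c
  refine h.congr_deriv ?_
  simp only [id]
  rw [Real.rpow_sub_one hxa.ne']
  field_simp

namespace IsWeightFunction

variable {φ : ℝ → ℝ}

/-! ### Growth of a weight function -/

theorem limsup_slope_le (hφ : IsWeightFunction φ) (hθ : theta φ ≠ ⊤) {s : ℝ} (hs : 0 < s) :
    limsup (fun t : ℝ => ENNReal.ofReal ((φ (s + t) - φ s) / t)) (𝓝[>] 0)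
      ≤ ENNReal.ofReal ((theta φ).toReal * φ s / s) := by
  have h : logSlope φ s ≤ theta φ := le_iSup₂_of_le s hs le_rfl
  have hc : 0 < s / φ s := div_pos hs (hφ.pos s hs)
  have e : (theta φ).toReal * φ s / s = (theta φ).toReal / (s / φ s) := by
    have := hφ.pos s hs
    field_simp
  rw [e, ENNReal.ofReal_div_of_pos hc, ENNReal.ofReal_toReal hθ, ENNReal.le_div_iff_mul_le
    (Or.inl (by simpa using hc)) (Or.inl (by simp)), mul_comm]
  exact h

theorem le_limsup_slope (hφ : IsWeightFunction φ) (hδ : delta φ ≠ ⊤) {s : ℝ} (hs : 0 < s) :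
    ENNReal.ofReal ((delta φ).toReal * φ s / s) ≤
      limsup (fun t : ℝ => ENNReal.ofReal ((φ (s + t) - φ s) / t)) (𝓝[>] 0) := by
  have h : delta φ ≤ logSlope φ s := iInf₂_le s hs
  have hc : 0 < s / φ s := div_pos hs (hφ.pos s hs)
  have e : (delta φ).toReal * φ s / s = (delta φ).toReal / (s / φ s) := by
    have := hφ.pos s hs
    field_simp
  rw [e, ENNReal.ofReal_div_of_pos hc, ENNReal.ofReal_toReal hδ]
  refine ENNReal.div_le_of_le_mul ?_
  rw [mul_comm]
  exact h

theorem map_add_nhdsGT_zero (x : ℝ) : map (fun t : ℝ => x + t) (𝓝[>] 0) = 𝓝[>] x := by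
  simp

/-- The right slopes of φ at x are at most θ φ(x)/x, while the power function solves y' = p y/x with
p > θ. At a contact point its slope is strictly larger, so φ cannot cross it. Letting p decrease to
θ gives `le_mul_rpow_theta`. -/
theorem le_rpow_mul_of_gt (hφ : IsWeightFunction φ) (hθ : theta φ ≠ ⊤) {a b p : ℝ} (ha : 0 < a)
    (hab : a ≤ b) (hp : (theta φ).toReal < p) : φ b ≤ φ a * (b / a) ^ p := by
  have hpos : ∀ x ∈ Icc a b, 0 < x := fun x hx => ha.trans_le hx.1
  refine image_le_of_liminf_slope_right_lt_deriv_boundary' (f := φ) (a := a) (b := b)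
    (f' := fun x => (theta φ).toReal * φ x / x)
    (B := fun x => φ a * (x / a) ^ p) (B' := fun x => p * (φ a * (x / a) ^ p) / x)
    (hφ.cont.mono hpos) ?_ (by simp [ha.ne']) ?_ ?_ ?_ (right_mem_Icc.2 hab)
  · intro x hx r hr
    have hx0 := hpos x (Ico_subset_Icc_self hx)
    have h1 := hφ.limsup_slope_le hθ hx0
    have h0 : 0 ≤ (theta φ).toReal * φ x / x := by
      have := hφ.pos x hx0
      positivity
    have h2 : limsup (fun t : ℝ => ENNReal.ofReal ((φ (x + t) - φ x) / t)) (𝓝[>] 0)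
        < ENNReal.ofReal r :=
      h1.trans_lt ((ENNReal.ofReal_lt_ofReal_iff (h0.trans_lt hr)).2 hr)
    have h3 := eventually_lt_of_limsup_lt h2
    rw [← map_add_nhdsGT_zero x]
    refine (Eventually.frequently ?_)
    rw [eventually_map]
    filter_upwards [h3] with t ht
    rw [slope_def_field]
    simpa using (ENNReal.ofReal_lt_ofReal_iff (h0.trans_lt hr)).1 ht
  · intro x hx
    exact (hasDerivAt_const_mul_div_rpow ha (hpos x hx) _ _).continuousAt.continuousWithinAt
  · intro x hx
    exact (hasDerivAt_const_mul_div_rpow ha (hpos x (Ico_subset_Icc_self hx)) _ _).hasDerivWithinAt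
  · intro x hx h
    have hx0 := hpos x (Ico_subset_Icc_self hx)
    have := hφ.pos x hx0
    rw [← h]
    gcongr

/-- The same comparison applied to -φ. It needs small slopes only for arbitrarily small increments,
which is exactly what a lower bound on a limsup provides. -/
theorem rpow_mul_le_of_lt (hφ : IsWeightFunction φ) (hδ : delta φ ≠ ⊤) {a b p : ℝ} (ha : 0 < a)
    (hab : a ≤ b) (hp : p < (delta φ).toReal) : φ a * (b / a) ^ p ≤ φ b := by
  have hpos : ∀ x ∈ Icc a b, 0 < x := fun x hx => ha.trans_le hx.1
  have key := image_le_of_liminf_slope_right_lt_deriv_boundary' (f := fun x => -φ x) (a := a)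
    (b := b) (f' := fun x => -((delta φ).toReal * φ x / x))
    (B := fun x => -φ a * (x / a) ^ p) (B' := fun x => p * (-φ a * (x / a) ^ p) / x)
    (hφ.cont.mono hpos).neg ?_ (by simp [ha.ne']) ?_ ?_ ?_ (right_mem_Icc.2 hab)
  · beta_reduce at key
    linarith
  · intro x hx r hr
    have hx0 := hpos x (Ico_subset_Icc_self hx)
    have h1 := hφ.le_limsup_slope hδ hx0
    rw [← map_add_nhdsGT_zero x, frequently_map]
    -- For r > 0 monotonicity of φ suffices. The limsup, taken in `ℝ≥0∞`, carries information only
    -- about thresholds -r ≥ 0.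
    rcases lt_or_ge 0 r with hr0 | hr0
    · refine Eventually.frequently ?_
      filter_upwards [self_mem_nhdsWithin] with t ht
      rw [slope_def_field]
      have ht0 : 0 < t := ht
      have : φ x ≤ φ (x + t) := hφ.mono hx0 (add_pos hx0 ht0) (by linarith)
      refine lt_of_le_of_lt ?_ hr0
      refine div_nonpos_of_nonpos_of_nonneg ?_ ?_ <;> linarith
    · have h0 : 0 < (delta φ).toReal * φ x / x := by
        linarith
      have h2 : ENNReal.ofReal (-r) <
          limsup (fun t : ℝ => ENNReal.ofReal ((φ (x + t) - φ x) / t)) (𝓝[>] 0) := by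
        refine lt_of_lt_of_le ?_ h1
        rw [ENNReal.ofReal_lt_ofReal_iff h0]
        linarith
      refine (frequently_lt_of_lt_limsup (by isBoundedDefault) h2).mono ?_
      intro t ht
      rw [slope_def_field]
      have := (ENNReal.ofReal_lt_ofReal_iff_of_nonneg (by linarith)).1 ht
      have e : (-φ (x + t) - -φ x) / (x + t - x) = -((φ (x + t) - φ x) / t) := by
        rw [add_sub_cancel_left, ← neg_div]
        congr 1
        ring
      rw [e]
      linarith
  · intro x hx
    exact (hasDerivAt_const_mul_div_rpow ha (hpos x hx) _ _).continuousAt.continuousWithinAt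
  · intro x hx
    exact (hasDerivAt_const_mul_div_rpow ha (hpos x (Ico_subset_Icc_self hx)) _ _).hasDerivWithinAt
  · intro x hx h
    have hx0 := hpos x (Ico_subset_Icc_self hx)
    have := hφ.pos x hx0
    rw [← h, mul_neg, neg_div]
    have : p * φ x / x < (delta φ).toReal * φ x / x := by gcongr
    linarith

theorem le_mul_rpow_theta (hφ : IsWeightFunction φ) (hθ : theta φ ≠ ⊤) {a b : ℝ} (ha : 0 < a)
    (hab : a ≤ b) : φ b ≤ φ a * (b / a) ^ (theta φ).toReal := by
  have hba : 0 < b / a := div_pos (ha.trans_le hab) ha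
  have hc : Tendsto (fun p : ℝ => φ a * (b / a) ^ p) (𝓝[>] (theta φ).toReal)
      (𝓝 (φ a * (b / a) ^ (theta φ).toReal)) :=
    ((Real.continuous_const_rpow hba.ne').continuousAt.tendsto.mono_left
      nhdsWithin_le_nhds).const_mul _
  exact ge_of_tendsto hc (by
    filter_upwards [self_mem_nhdsWithin] with p hp using hφ.le_rpow_mul_of_gt hθ ha hab hp)

theorem mul_rpow_delta_le (hφ : IsWeightFunction φ) (hδ : delta φ ≠ ⊤) {a b : ℝ} (ha : 0 < a)
    (hab : a ≤ b) : φ a * (b / a) ^ (delta φ).toReal ≤ φ b := by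
  have hba : 0 < b / a := div_pos (ha.trans_le hab) ha
  have hc : Tendsto (fun p : ℝ => φ a * (b / a) ^ p) (𝓝[<] (delta φ).toReal)
      (𝓝 (φ a * (b / a) ^ (delta φ).toReal)) :=
    ((Real.continuous_const_rpow hba.ne').continuousAt.tendsto.mono_left
      nhdsWithin_le_nhds).const_mul _
  exact le_of_tendsto hc (by
    filter_upwards [self_mem_nhdsWithin] with p hp using hφ.rpow_mul_le_of_lt hδ ha hab hp)

/-! ### The logarithm of a weight function -/

theorem intervalIntegrable_inv (hφ : IsWeightFunction φ) {a b : ℝ} (ha : 0 < a) (hb : 0 < b) :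
    IntervalIntegrable (fun s => (φ s)⁻¹) volume a b := by
  have hsub : uIcc a b ⊆ Ioi 0 := fun x hx => lt_of_lt_of_le (lt_min ha hb) hx.1
  exact ((hφ.cont.mono hsub).inv₀ fun x hx => (hφ.pos x (hsub hx)).ne').intervalIntegrable

theorem lnPhi_sub (hφ : IsWeightFunction φ) {a b : ℝ} (ha : 0 < a) (hb : 0 < b) :
    lnPhi φ b - lnPhi φ a = ∫ s in a..b, (φ s)⁻¹ :=
  intervalIntegral.integral_interval_sub_left (hφ.intervalIntegrable_inv one_pos hb)
    (hφ.intervalIntegrable_inv one_pos ha)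

theorem _root_.PhiEntropy.lnPhi_one : lnPhi φ 1 = 0 := by simp [lnPhi]

theorem strictMonoOn_lnPhi (hφ : IsWeightFunction φ) : StrictMonoOn (lnPhi φ) (Ioi 0) := by
  intro a ha b hb hab
  rw [← sub_pos, hφ.lnPhi_sub ha hb]
  exact intervalIntegral.intervalIntegral_pos_of_pos_on (hφ.intervalIntegrable_inv ha hb)
    (fun x hx => inv_pos.2 (hφ.pos x (lt_trans ha hx.1))) hab

theorem hasDerivAt_lnPhi (hφ : IsWeightFunction φ) {t : ℝ} (ht : 0 < t) :
    HasDerivAt (lnPhi φ) (φ t)⁻¹ t := by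
  have hc : ContinuousOn (fun s => (φ s)⁻¹) (Ioi 0) :=
    hφ.cont.inv₀ fun x hx => (hφ.pos x hx).ne'
  exact intervalIntegral.integral_hasDerivAt_right (hφ.intervalIntegrable_inv one_pos ht)
    (hc.stronglyMeasurableAtFilter isOpen_Ioi t ht) (hc.continuousAt (Ioi_mem_nhds ht))

theorem continuousOn_lnPhi (hφ : IsWeightFunction φ) : ContinuousOn (lnPhi φ) (Ioi 0) :=
  fun _ ht => (hφ.hasDerivAt_lnPhi ht).continuousAt.continuousWithinAt

theorem lnPhi_sub_le (hφ : IsWeightFunction φ) {s t : ℝ} (hs : 0 < s) (ht : 0 < t) :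
    lnPhi φ t - lnPhi φ s ≤ (t - s) / φ s := by
  have hp := hφ.pos s hs
  rcases le_total s t with h | h
  · rw [hφ.lnPhi_sub hs ht]
    calc ∫ x in s..t, (φ x)⁻¹ ≤ ∫ _ in s..t, (φ s)⁻¹ := by
          refine intervalIntegral.integral_mono_on h (hφ.intervalIntegrable_inv hs ht) (by simp) ?_
          intro x hx
          exact inv_anti₀ hp (hφ.mono hs (hs.trans_le hx.1) hx.1)
      _ = (t - s) / φ s := by simp [div_eq_mul_inv]
  · have : ∫ _ in t..s, (φ s)⁻¹ ≤ ∫ x in t..s, (φ x)⁻¹ := by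
      refine intervalIntegral.integral_mono_on h (by simp) (hφ.intervalIntegrable_inv ht hs) ?_
      intro x hx
      have hx0 := ht.trans_le hx.1
      exact inv_anti₀ (hφ.pos x hx0) (hφ.mono hx0 hs hx.2)
    rw [← hφ.lnPhi_sub ht hs] at this
    simp only [intervalIntegral.integral_const, smul_eq_mul] at this
    rw [div_eq_mul_inv]
    linarith

/-- The integrability at `0` of the logarithm of a weight function that is large near `0`. -/
theorem neg_lnPhi_le (hφ : IsWeightFunction φ) (h : ∀ s, 0 < s → s ≤ 1 → s ^ (3 / 2 : ℝ) ≤ φ s)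
    {t : ℝ} (ht : 0 < t) (ht1 : t ≤ 1) : -lnPhi φ t ≤ 2 * t ^ (-(1 / 2) : ℝ) := by
  have e : -lnPhi φ t = ∫ s in t..1, (φ s)⁻¹ := by
    rw [← hφ.lnPhi_sub ht one_pos, lnPhi_one]
    ring
  have hz : (0 : ℝ) ∉ uIcc t 1 := by
    rw [uIcc_of_le ht1]
    exact fun hx => absurd hx.1 (not_le.2 ht)
  rw [e]
  calc ∫ s in t..1, (φ s)⁻¹ ≤ ∫ s in t..1, s ^ (-(3 / 2) : ℝ) := by
        refine intervalIntegral.integral_mono_on ht1 (hφ.intervalIntegrable_inv ht one_pos)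
          (intervalIntegral.intervalIntegrable_rpow (Or.inr hz)) ?_
        intro x hx
        have hx0 := ht.trans_le hx.1
        rw [Real.rpow_neg hx0.le]
        exact inv_anti₀ (by positivity) (h x hx0 hx.2)
    _ = (1 - t ^ (-(1 / 2) : ℝ)) / (-(1 / 2)) := by
        rw [integral_rpow (Or.inr ⟨by norm_num, hz⟩)]
        norm_num
    _ ≤ 2 * t ^ (-(1 / 2) : ℝ) := by
        rw [div_le_iff_of_neg (by norm_num)]
        linarith

/-- Growth from s to 1 gives s^θ ≤ φ(s), and θ < 3/2. This makes ln_φ integrable at 0, so that u_φ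
is a genuine integral and not a default value. -/
theorem rpow_le (hφ : IsWeightFunction φ) (h1 : φ 1 = 1)
    (hθ : theta φ < ENNReal.ofReal (3 / 2)) {s : ℝ} (hs : 0 < s) (hs1 : s ≤ 1) :
    s ^ (3 / 2 : ℝ) ≤ φ s := by
  have hθ' : (theta φ).toReal ≤ 3 / 2 := by
    have := ENNReal.toReal_mono (by simp) hθ.le
    rwa [ENNReal.toReal_ofReal (by norm_num)] at this
  have := hφ.le_mul_rpow_theta hθ.ne_top hs hs1
  rw [h1, one_div, Real.inv_rpow hs.le, ← div_eq_mul_inv, le_div_iff₀ (by positivity),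
    one_mul] at this
  exact (Real.rpow_le_rpow_of_exponent_ge hs hs1 hθ').trans this

theorem intervalIntegrable_lnPhi (hφ : IsWeightFunction φ)
    (h : ∀ s, 0 < s → s ≤ 1 → s ^ (3 / 2 : ℝ) ≤ φ s) {a b : ℝ} (ha : 0 ≤ a) (hb : 0 ≤ b) :
    IntervalIntegrable (lnPhi φ) volume a b := by
  have h01 : IntervalIntegrable (lnPhi φ) volume 0 1 := by
    have hg : IntervalIntegrable (fun t : ℝ => 2 * t ^ (-(1 / 2) : ℝ)) volume 0 1 :=
      (intervalIntegral.intervalIntegrable_rpow' (by norm_num)).const_mul 2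
    rw [intervalIntegrable_iff_integrableOn_Ioc_of_le zero_le_one] at hg ⊢
    refine Integrable.mono' hg ((hφ.continuousOn_lnPhi.mono fun x hx => hx.1).aestronglyMeasurable
      measurableSet_Ioc) ?_
    filter_upwards [ae_restrict_mem measurableSet_Ioc] with t ht
    have : lnPhi φ t ≤ 0 := by
      rw [← lnPhi_one (φ := φ)]
      exact hφ.strictMonoOn_lnPhi.monotoneOn ht.1 (mem_Ioi.2 one_pos) ht.2
    rw [Real.norm_eq_abs, abs_of_nonpos this]
    exact hφ.neg_lnPhi_le h ht.1 ht.2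
  have h0 : ∀ b, 0 ≤ b → IntervalIntegrable (lnPhi φ) volume 0 b := by
    intro b hb
    rcases hb.eq_or_lt with rfl | hb
    · simp
    refine h01.trans (hφ.continuousOn_lnPhi.mono ?_).intervalIntegrable
    exact fun x hx => lt_of_lt_of_le (lt_min one_pos hb) hx.1
  exact (h0 a ha).symm.trans (h0 b hb)

/-! ### The primitive of the logarithm -/

theorem _root_.PhiEntropy.uPhi_zero : uPhi φ 0 = 0 := by simp [uPhi]

theorem measurable_uPhi_comp (hφ : IsWeightFunction φ)
    (h : ∀ s, 0 < s → s ≤ 1 → s ^ (3 / 2 : ℝ) ≤ φ s) {X : Type*} [MeasurableSpace X]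
    {g : X → ℝ} (hg : Measurable g) (hg0 : ∀ x, 0 ≤ g x) :
    Measurable fun x => uPhi φ (g x) := by
  -- Nothing is known of ln_φ on the negative axis. Cutting it off there leaves u_φ unchanged on
  -- [0,∞) and gives a primitive continuous on the whole line.
  have hI : ∀ a b, IntervalIntegrable ((Ioi 0).indicator (lnPhi φ)) volume a b := by
    have h0 : ∀ b, IntervalIntegrable ((Ioi 0).indicator (lnPhi φ)) volume 0 b := by
      intro b
      rcases le_total 0 b with hb | hb
      · refine (hφ.intervalIntegrable_lnPhi h le_rfl hb).congr ?_
        intro t ht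
        rw [uIoc_of_le hb] at ht
        exact (indicator_of_mem (show t ∈ Ioi (0 : ℝ) from ht.1) _).symm
      · refine (IntervalIntegrable.congr (f := fun _ => (0 : ℝ)) ?_ (by simp))
        intro t ht
        rw [uIoc_of_ge hb] at ht
        exact (indicator_of_notMem (fun h' : t ∈ Ioi (0 : ℝ) => absurd ht.2 (not_le.2 h')) _).symm
    exact fun a b => (h0 a).symm.trans (h0 b)
  have hc := (intervalIntegral.continuous_primitive hI 0).measurable.comp hg
  convert hc using 2 with x
  refine intervalIntegral.integral_congr_ae (Eventually.of_forall fun t ht => ?_)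
  rw [uIoc_of_le (hg0 x)] at ht
  exact (indicator_of_mem (show t ∈ Ioi (0 : ℝ) from ht.1) _).symm

theorem uPhi_sub (hφ : IsWeightFunction φ)
    (h : ∀ s, 0 < s → s ≤ 1 → s ^ (3 / 2 : ℝ) ≤ φ s) {a b : ℝ} (ha : 0 ≤ a) (hb : 0 ≤ b) :
    uPhi φ b - uPhi φ a = ∫ t in a..b, lnPhi φ t :=
  intervalIntegral.integral_interval_sub_left (hφ.intervalIntegrable_lnPhi h le_rfl hb)
    (hφ.intervalIntegrable_lnPhi h le_rfl ha)

/-- A lower bound for the slope of `u_φ` at `s`, expressed through a constant `c`. -/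
theorem mul_sub_le_uPhi_sub (hφ : IsWeightFunction φ)
    (h : ∀ s, 0 < s → s ≤ 1 → s ^ (3 / 2 : ℝ) ≤ φ s) {s r c : ℝ} (hs : 0 ≤ s) (hr : 0 ≤ r)
    (h1 : ∀ t, s < t → c ≤ lnPhi φ t) (h2 : ∀ t, 0 < t → t < s → lnPhi φ t ≤ c) :
    c * (r - s) ≤ uPhi φ r - uPhi φ s := by
  rw [hφ.uPhi_sub h hs hr]
  rcases le_total s r with hsr | hsr
  · have := intervalIntegral.integral_mono_on_of_le_Ioo (f := fun _ => c) (μ := volume) hsr (by simp)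
      (hφ.intervalIntegrable_lnPhi h hs hr) (fun t ht => h1 t ht.1)
    simpa [mul_comm] using this
  · have := intervalIntegral.integral_mono_on_of_le_Ioo (g := fun _ => c) (μ := volume) hsr
      (hφ.intervalIntegrable_lnPhi h hr hs) (by simp) (fun t ht => h2 t (hr.trans_lt ht.1) ht.2)
    rw [intervalIntegral.integral_symm]
    simp only [intervalIntegral.integral_const, smul_eq_mul] at this
    linarith

theorem lnPhi_mul_sub_le (hφ : IsWeightFunction φ)
    (h : ∀ s, 0 < s → s ≤ 1 → s ^ (3 / 2 : ℝ) ≤ φ s) {s r : ℝ} (hs : 0 < s) (hr : 0 ≤ r) :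
    lnPhi φ s * (r - s) ≤ uPhi φ r - uPhi φ s :=
  hφ.mul_sub_le_uPhi_sub h hs.le hr
    (fun _ ht => hφ.strictMonoOn_lnPhi.monotoneOn hs (hs.trans ht) ht.le)
    (fun _ ht hts => hφ.strictMonoOn_lnPhi.monotoneOn ht hs hts.le)

/-- Integrate the tangent line of the concave function ln_φ at s over (0, xs). The factor x²/2 - x
is nonpositive for 0 ≤ x ≤ 2, hence for x = 1/c with c ≥ 1/2; at x = 1 the estimate bounds s²/φ(s)
itself. -/
theorem uPhi_mul_le (hφ : IsWeightFunction φ)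
    (h : ∀ s, 0 < s → s ≤ 1 → s ^ (3 / 2 : ℝ) ≤ φ s) {s x : ℝ} (hs : 0 < s) (hx : 0 ≤ x) :
    uPhi φ (x * s) - x * s * lnPhi φ s ≤ (x ^ 2 / 2 - x) * (s ^ 2 / φ s) := by
  have hxs : 0 ≤ x * s := by positivity
  have := intervalIntegral.integral_mono_on_of_le_Ioo (μ := volume) hxs
    (g := fun t => lnPhi φ s + (t - s) * (φ s)⁻¹)
    (hφ.intervalIntegrable_lnPhi h le_rfl hxs)
    (Continuous.intervalIntegrable (by fun_prop) _ _) (fun t ht => by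
      have := hφ.lnPhi_sub_le hs ht.1
      rw [div_eq_mul_inv] at this
      linarith)
  have e : ∫ t in (0 : ℝ)..(x * s), (lnPhi φ s + (t - s) * (φ s)⁻¹)
      = x * s * lnPhi φ s + (x ^ 2 / 2 - x) * (s ^ 2 / φ s) := by
    rw [intervalIntegral.integral_add (by simp) (Continuous.intervalIntegrable (by fun_prop) _ _),
      intervalIntegral.integral_mul_const, intervalIntegral.integral_sub (by simp) (by simp)]
    simp
    ring
  rw [e] at this
  unfold uPhi
  linarith

theorem uPhi_div_le (hφ : IsWeightFunction φ)
    (h : ∀ s, 0 < s → s ≤ 1 → s ^ (3 / 2 : ℝ) ≤ φ s) {r : ℝ} (hr : 0 < r) :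
    uPhi φ r ≤ r * lnPhi φ r := by
  have := hφ.lnPhi_mul_sub_le h hr le_rfl
  rw [uPhi_zero] at this
  linarith

/-- Scaling bound for increments of the logarithm. -/
theorem lnPhi_div_sub_le (hφ : IsWeightFunction φ) (hθ : theta φ ≠ ⊤) (hδ : delta φ ≠ ⊤)
    (hδθ : delta φ ≤ theta φ) {b s ξ : ℝ} (hb : 0 < b) (hb1 : b ≤ 1) (hbξ : b ≤ ξ) (hs : 0 < s)
    (hsξ : s ≤ ξ) :
    lnPhi φ (s / b) - lnPhi φ s ≤
      b ^ ((delta φ).toReal - 1) * -lnPhi φ b * ξ ^ ((theta φ).toReal - (delta φ).toReal)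
        * s ^ (1 - (theta φ).toReal) := by
  have hle : (delta φ).toReal ≤ (theta φ).toReal := ENNReal.toReal_mono hθ hδθ
  generalize htθ : (theta φ).toReal = θ at *
  generalize htδ : (delta φ).toReal = δ at *
  have hξ : 0 < ξ := hb.trans_le hbξ
  set c := s / b with hc
  have hc0 : 0 < c := div_pos hs hb
  have hcb : s = c * b := by rw [hc]; field_simp
  set C := b ^ (δ - 1) * ξ ^ (θ - δ) * s ^ (1 - θ) with hC
  have hCpos : 0 < C := by positivity
  -- After the substitution by cτ, the increment of ln_φ from s to c = s/b becomes an integral over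
  -- (b, 1). For c ≥ 1 the exponent δ is used and s ≤ ξ absorbs s^(θ-δ); for c ≤ 1 the exponent θ is
  -- used and b ≤ ξ absorbs b^(θ-δ).
  have hφle : ∀ τ, 0 < τ → c * (φ (c * τ))⁻¹ ≤ C * (φ τ)⁻¹ := by
    intro τ hτ
    have hφτ := hφ.pos τ hτ
    have hφc := hφ.pos (c * τ) (by positivity)
    rcases le_total 1 c with h1 | h1
    · have := hφ.mul_rpow_delta_le hδ hτ (le_mul_of_one_le_left hτ.le h1)
      rw [mul_div_assoc, div_self hτ.ne', mul_one, htδ] at this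
      have h2 : c ^ (1 - δ) ≤ C := by
        have e : c ^ (1 - δ) = b ^ (δ - 1) * s ^ (θ - δ) * s ^ (1 - θ) := by
          rw [mul_assoc, ← Real.rpow_add hs, hc, Real.div_rpow hs.le hb.le, div_eq_mul_inv,
            ← Real.rpow_neg hb.le, mul_comm]
          congr 2 <;> ring
        rw [e, hC]
        gcongr
      calc c * (φ (c * τ))⁻¹ ≤ c * (φ τ * c ^ δ)⁻¹ := by gcongr
        _ = c ^ (1 - δ) * (φ τ)⁻¹ := by
          rw [Real.rpow_sub hc0, Real.rpow_one]
          field_simp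
        _ ≤ _ := by gcongr
    · have := hφ.le_mul_rpow_theta hθ (a := c * τ) (b := τ) (by positivity)
        (mul_le_of_le_one_left hτ.le h1)
      have e1 : τ / (c * τ) = c⁻¹ := by field_simp
      rw [e1, htθ, Real.inv_rpow hc0.le, ← div_eq_mul_inv, le_div_iff₀ (by positivity)] at this
      have h2 : c ^ (1 - θ) ≤ C := by
        have e : c ^ (1 - θ) = b ^ (δ - 1) * b ^ (θ - δ) * s ^ (1 - θ) := by
          rw [← Real.rpow_add hb, hc, Real.div_rpow hs.le hb.le, div_eq_mul_inv,
            ← Real.rpow_neg hb.le, mul_comm]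
          congr 2; ring
        rw [e, hC]
        gcongr
      calc c * (φ (c * τ))⁻¹ ≤ c * (φ τ * c ^ θ)⁻¹ := by gcongr
        _ = c ^ (1 - θ) * (φ τ)⁻¹ := by
          rw [Real.rpow_sub hc0, Real.rpow_one]
          field_simp
        _ ≤ _ := by gcongr
  have e1 : lnPhi φ c - lnPhi φ s = ∫ τ in b..1, c * (φ (c * τ))⁻¹ := by
    rw [hφ.lnPhi_sub hs hc0, intervalIntegral.integral_const_mul,
      intervalIntegral.integral_comp_mul_left (fun x => (φ x)⁻¹) hc0.ne', ← hcb, mul_one,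
      smul_eq_mul, ← mul_assoc, mul_inv_cancel₀ hc0.ne', one_mul]
  have e2 : -lnPhi φ b = ∫ τ in b..1, (φ τ)⁻¹ := by
    rw [← hφ.lnPhi_sub hb one_pos, lnPhi_one, zero_sub]
  have e3 : b ^ (δ - 1) * -lnPhi φ b * ξ ^ (θ - δ) * s ^ (1 - θ)
      = ∫ τ in b..1, C * (φ τ)⁻¹ := by
    rw [intervalIntegral.integral_const_mul, ← e2, hC]
    ring
  rw [e1, e3]
  have hc' : ContinuousOn (fun τ => c * (φ (c * τ))⁻¹) (uIcc b 1) := by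
    have hsub : ∀ τ ∈ uIcc b 1, 0 < c * τ := fun τ hτ =>
      mul_pos hc0 ((lt_min hb one_pos).trans_le hτ.1)
    refine continuousOn_const.mul (ContinuousOn.inv₀ ?_ fun τ hτ => (hφ.pos _ (hsub τ hτ)).ne')
    exact hφ.cont.comp (by fun_prop) hsub
  exact intervalIntegral.integral_mono_on hb1 hc'.intervalIntegrable
    ((hφ.intervalIntegrable_inv hb one_pos).const_mul C) fun τ hτ => hφle τ (hb.trans_le hτ.1)

/-- Since u_φ(r) ≤ r ln_φ(r), the left side is at most s/b times the increment of ln_φ from s to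
s/b. -/
theorem uPhi_div_sub_le (hφ : IsWeightFunction φ)
    (h : ∀ s, 0 < s → s ≤ 1 → s ^ (3 / 2 : ℝ) ≤ φ s) (hθ : theta φ ≠ ⊤) (hδ : delta φ ≠ ⊤)
    (hδθ : delta φ ≤ theta φ) {b s ξ : ℝ} (hb : 0 < b) (hb1 : b ≤ 1) (hbξ : b ≤ ξ) (hs : 0 < s)
    (hsξ : s ≤ ξ) :
    uPhi φ (s / b) - s / b * lnPhi φ s ≤
      b ^ ((delta φ).toReal - 2) * -lnPhi φ b * ξ ^ ((theta φ).toReal - (delta φ).toReal)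
        * s ^ (2 - (theta φ).toReal) := by
  have hsb : 0 < s / b := div_pos hs hb
  have h1 := hφ.uPhi_div_le h hsb
  have h2 := mul_le_mul_of_nonneg_left (hφ.lnPhi_div_sub_le hθ hδ hδθ hb hb1 hbξ hs hsξ) hsb.le
  have e1 : b ^ ((delta φ).toReal - 1) = b ^ ((delta φ).toReal - 2) * b := by
    rw [← Real.rpow_add_one hb.ne']
    congr 1; ring
  have e2 : s ^ (2 - (theta φ).toReal) = s ^ (1 - (theta φ).toReal) * s := by
    rw [← Real.rpow_add_one hs.ne']
    congr 1; ring
  rw [e1] at h2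
  rw [e2]
  refine le_trans (by linarith) (h2.trans_eq ?_)
  field_simp

end IsWeightFunction

theorem delta_le_theta (φ : ℝ → ℝ) : delta φ ≤ theta φ :=
  (iInf₂_le (1 : ℝ) one_pos).trans (le_iSup₂_of_le (1 : ℝ) one_pos le_rfl)

/-! ### The exponential of a weight function -/

section Exponential

variable {φ : ℝ → ℝ}

theorem lowerLog_le {t : ℝ} (ht : 0 < t) : lowerLog φ ≤ (lnPhi φ t : EReal) := iInf₂_le t ht

theorem le_upperLog {t : ℝ} (ht : 0 < t) : (lnPhi φ t : EReal) ≤ upperLog φ :=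
  le_iSup₂_of_le t ht le_rfl

theorem lowerLog_nonpos : lowerLog φ ≤ 0 := by
  simpa [lnPhi_one] using lowerLog_le (φ := φ) one_pos

theorem upperLog_nonneg : 0 ≤ upperLog φ := by
  simpa [lnPhi_one] using le_upperLog (φ := φ) one_pos

theorem lowerLog_toReal_nonpos : (lowerLog φ).toReal ≤ 0 := EReal.toReal_nonpos lowerLog_nonpos

theorem upperLog_toReal_nonneg : 0 ≤ (upperLog φ).toReal := EReal.toReal_nonneg upperLog_nonneg

theorem IsWeightFunction.lowerLog_lt_upperLog (hφ : IsWeightFunction φ) :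
    lowerLog φ < upperLog φ := by
  refine (lowerLog_le one_pos).trans_lt (lt_of_lt_of_le ?_ (le_upperLog two_pos))
  exact_mod_cast hφ.strictMonoOn_lnPhi (mem_Ioi.2 one_pos) (mem_Ioi.2 two_pos) one_lt_two

theorem IsWeightFunction.expPhi_eq_ofReal (hφ : IsWeightFunction φ) {τ : ℝ}
    (h1 : lowerLog φ < τ) (h2 : (τ : EReal) < upperLog φ) :
    ∃ t, 0 < t ∧ expPhi φ τ = ENNReal.ofReal t ∧ lnPhi φ t = τ := by
  have hmem : τ ∈ lnPhi φ '' Ioi 0 := by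
    unfold lowerLog at h1
    unfold upperLog at h2
    simp only [iInf_lt_iff, lt_iSup_iff, EReal.coe_lt_coe_iff] at h1 h2
    obtain ⟨a, ha, hab⟩ := h1
    obtain ⟨b, hb, hbb⟩ := h2
    have hsub : uIcc a b ⊆ Ioi 0 := fun x hx => lt_of_lt_of_le (lt_min ha hb) hx.1
    have := intermediate_value_uIcc (hφ.continuousOn_lnPhi.mono hsub)
      (show τ ∈ uIcc (lnPhi φ a) (lnPhi φ b) from mem_uIcc_of_le hab.le hbb.le)
    exact image_mono hsub this
  refine ⟨Function.invFunOn (lnPhi φ) (Ioi 0) τ, Function.invFunOn_mem hmem, ?_,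
    Function.invFunOn_eq hmem⟩
  rw [expPhi, if_neg (not_le.2 h1), if_neg (not_le.2 h2)]

theorem expPhi_eq_zero {τ : ℝ} (h : (τ : EReal) ≤ lowerLog φ) : expPhi φ τ = 0 := by
  rw [expPhi, if_pos h]

theorem IsWeightFunction.expPhi_eq_top (hφ : IsWeightFunction φ) {τ : ℝ}
    (h : upperLog φ ≤ (τ : EReal)) : expPhi φ τ = ⊤ := by
  rw [expPhi, if_neg (not_le.2 (hφ.lowerLog_lt_upperLog.trans_le h)), if_pos h]

theorem IsWeightFunction.monotone_expPhi (hφ : IsWeightFunction φ) : Monotone (expPhi φ) := by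
  intro τ₁ τ₂ h
  have h' : (τ₁ : EReal) ≤ τ₂ := by exact_mod_cast h
  rcases le_or_gt (τ₁ : EReal) (lowerLog φ) with h1 | h1
  · simp [expPhi_eq_zero h1]
  rcases le_or_gt (upperLog φ) (τ₂ : EReal) with h2 | h2
  · simp [hφ.expPhi_eq_top h2]
  obtain ⟨s, hs, es, ls⟩ := hφ.expPhi_eq_ofReal h1 (h'.trans_lt h2)
  obtain ⟨t, ht, et, lt⟩ := hφ.expPhi_eq_ofReal (h1.trans_le h') h2
  rw [es, et]
  refine ENNReal.ofReal_le_ofReal ((hφ.strictMonoOn_lnPhi.le_iff_le hs ht).1 ?_)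
  rwa [ls, lt]

end Exponential

/-! ### Convexity of `h_φ` -/

theorem hPhi_zero {φ : ℝ → ℝ} : hPhi φ 0 = 0 := by simp [hPhi, uPhi_zero]

/-- The tangent at s lies below the convex function h_φ. At s = 0 the slope is l_φ, whose real value
is meaningful only when l_φ is finite. -/
theorem IsWeightFunction.hPhi_tangent_le {φ : ℝ → ℝ} (hφ : IsWeightFunction φ)
    (h : ∀ s, 0 < s → s ≤ 1 → s ^ (3 / 2 : ℝ) ≤ φ s) {s r : ℝ} (hs : 0 ≤ s) (hr : 0 ≤ r)
    (hl : s = 0 → lowerLog φ ≠ ⊥) :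
    hPhi φ s - hPhiDeriv φ s * s ≤ hPhi φ r - hPhiDeriv φ s * r := by
  have key : (if 0 < s then lnPhi φ s else (lowerLog φ).toReal) * (r - s)
      ≤ uPhi φ r - uPhi φ s := by
    rcases hs.eq_or_lt with rfl | hs
    · refine hφ.mul_sub_le_uPhi_sub h le_rfl hr (fun t ht => ?_)
        (fun t ht ht' => absurd ht (not_lt.2 ht'.le))
      have := lowerLog_le (φ := φ) ht
      rw [← EReal.coe_toReal (ne_top_of_le_ne_top (by simp) lowerLog_nonpos) (hl rfl)] at this
      simpa using this
    · rw [if_pos hs]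
      exact hφ.lnPhi_mul_sub_le h hs hr
  unfold hPhi hPhiDeriv
  split_ifs at key ⊢ <;> linarith

theorem hPhiDeriv_nonpos {φ : ℝ → ℝ} (hL : upperLog φ ≠ ⊤) (s : ℝ) : hPhiDeriv φ s ≤ 0 := by
  rw [hPhiDeriv, if_neg hL, sub_nonpos]
  split_ifs with hs
  · have := le_upperLog (φ := φ) hs
    rw [← EReal.coe_toReal hL (ne_bot_of_le_ne_bot (by simp) upperLog_nonneg)] at this
    exact_mod_cast this
  · exact lowerLog_toReal_nonpos.trans upperLog_toReal_nonneg

/-! ### Entropies of normalized restrictions of the reference measure -/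

/-- The measure-theoretic part of the assumptions on `(ωM, φ, Ψ)`. -/
structure EntropySetting {X : Type*} [MeasurableSpace X] (ωM : Measure X) (φ : ℝ → ℝ)
    (Ψ : X → ℝ) : Prop where
  weight : IsWeightFunction φ
  rpow_le : ∀ s, 0 < s → s ≤ 1 → s ^ (3 / 2 : ℝ) ≤ φ s
  measurable_potential : Measurable Ψ
  isProbabilityMeasure : IsProbabilityMeasure (refMeasure ωM φ Ψ)
  integrable_h : Integrable (fun x => hPhi φ (refDensity φ Ψ x)) ωM
  integrable_ln : Integrable (fun x => refDensity φ Ψ x * lnPhi φ (refDensity φ Ψ x)) ωM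

/-- The integrand of the entropy of the normalized restriction of the reference measure to a set
of mass `c`. -/
noncomputable def entropyIntegrand {X : Type*} (φ : ℝ → ℝ) (Ψ : X → ℝ) (c : ℝ) (x : X) : ℝ :=
  uPhi φ (refDensity φ Ψ x / c) - refDensity φ Ψ x / c * lnPhi φ (refDensity φ Ψ x)

theorem refDensity_nonneg {X : Type*} {φ : ℝ → ℝ} {Ψ : X → ℝ} (x : X) : 0 ≤ refDensity φ Ψ x :=
  ENNReal.toReal_nonneg

theorem entropyIntegrand_of_zero {X : Type*} {φ : ℝ → ℝ} {Ψ : X → ℝ} {c : ℝ} {x : X} (h : refDensity φ Ψ x = 0) :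
    entropyIntegrand φ Ψ c x = 0 := by
  simp [entropyIntegrand, h, uPhi_zero]

theorem hPhi_sub_eq_entropyIntegrand {X : Type*} {φ : ℝ → ℝ} {Ψ : X → ℝ} (c : ℝ) (x : X) :
    hPhi φ (refDensity φ Ψ x / c) - c⁻¹ * (refDensity φ Ψ x * hPhiDeriv φ (refDensity φ Ψ x))
      = entropyIntegrand φ Ψ c x := by
  rcases (refDensity_nonneg (φ := φ) (Ψ := Ψ) x).eq_or_lt with h | h
  · rw [entropyIntegrand_of_zero h.symm, ← h]
    simp [hPhi_zero]
  · simp only [hPhi, hPhiDeriv, if_pos h, entropyIntegrand]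
    split_ifs <;> ring

namespace EntropySetting

variable {X : Type*} [MeasurableSpace X] {ωM : Measure X} {φ : ℝ → ℝ} {Ψ : X → ℝ}

theorem measurable_expPhi (S : EntropySetting ωM φ Ψ) : Measurable fun x => expPhi φ (-Ψ x) :=
  S.weight.monotone_expPhi.measurable.comp S.measurable_potential.neg

theorem measurable_refDensity (S : EntropySetting ωM φ Ψ) : Measurable (refDensity φ Ψ) :=
  S.measurable_expPhi.ennreal_toReal

theorem lintegral_expPhi (S : EntropySetting ωM φ Ψ) : ∫⁻ x, expPhi φ (-Ψ x) ∂ωM = 1 := by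
  have := S.isProbabilityMeasure.measure_univ
  rwa [refMeasure, withDensity_apply _ MeasurableSet.univ, setLIntegral_univ] at this

theorem ae_lt_top (S : EntropySetting ωM φ Ψ) : ∀ᵐ x ∂ωM, expPhi φ (-Ψ x) < ⊤ :=
  MeasureTheory.ae_lt_top S.measurable_expPhi (by simp [S.lintegral_expPhi])

theorem integrable_refDensity (S : EntropySetting ωM φ Ψ) : Integrable (refDensity φ Ψ) ωM :=
  integrable_toReal_of_lintegral_ne_top S.measurable_expPhi.aemeasurable
    (by simp [S.lintegral_expPhi])

/-- If l_φ = -∞, the exponential is positive everywhere; σ can then vanish only where the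
exponential is infinite, which is a null set because ν has finite mass. -/
theorem ae_lowerLog_ne_bot (S : EntropySetting ωM φ Ψ) :
    ∀ᵐ x ∂ωM, refDensity φ Ψ x = 0 → lowerLog φ ≠ ⊥ := by
  filter_upwards [S.ae_lt_top] with x hx h0 hbot
  have h1 : lowerLog φ < (-Ψ x : ℝ) := by
    rw [hbot]
    exact EReal.bot_lt_coe _
  have h2 : ((-Ψ x : ℝ) : EReal) < upperLog φ :=
    not_le.1 fun h => hx.ne (S.weight.expPhi_eq_top h)
  obtain ⟨t, ht, et, -⟩ := S.weight.expPhi_eq_ofReal h1 h2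
  rw [refDensity, et, ENNReal.toReal_ofReal ht.le] at h0
  exact ht.ne' h0

theorem refMeasure_compl_positivitySet (S : EntropySetting ωM φ Ψ) :
    refMeasure ωM φ Ψ (positivitySet φ Ψ)ᶜ = 0 := by
  rw [← mem_ae_iff, refMeasure]
  change ∀ᵐ x ∂_, x ∈ positivitySet φ Ψ
  rw [ae_withDensity_iff S.measurable_expPhi]
  filter_upwards [S.ae_lt_top] with x hx h0
  have h1 : lowerLog φ < (-Ψ x : ℝ) := not_le.1 fun h => h0 (expPhi_eq_zero h)
  have h2 : ((-Ψ x : ℝ) : EReal) < upperLog φ :=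
    not_le.1 fun h => hx.ne (S.weight.expPhi_eq_top h)
  rw [EReal.coe_neg] at h1 h2
  exact ⟨EReal.neg_lt_comm.1 h2, EReal.lt_neg_comm.1 h1⟩

theorem integrable_uPhi (S : EntropySetting ωM φ Ψ) :
    Integrable (fun x => uPhi φ (refDensity φ Ψ x)) ωM := by
  by_cases hL : upperLog φ = ⊤
  · simpa [hPhi, hL] using S.integrable_h
  · refine (S.integrable_h.add (S.integrable_refDensity.mul_const (upperLog φ).toReal)).congr ?_
    exact Eventually.of_forall fun x => by simp [hPhi, hL]

/-- An integrable majorant, up to constants, of the entropy integrands. -/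
noncomputable def _root_.PhiEntropy.entropyDefect {X : Type*} (φ : ℝ → ℝ) (Ψ : X → ℝ) (x : X) : ℝ :=
  2 * (refDensity φ Ψ x * lnPhi φ (refDensity φ Ψ x) - uPhi φ (refDensity φ Ψ x))

theorem integrable_entropyDefect (S : EntropySetting ωM φ Ψ) :
    Integrable (entropyDefect φ Ψ) ωM :=
  (S.integrable_ln.sub S.integrable_uPhi).const_mul 2

/-- `uPhi_mul_le` at x = 1 bounds σ²/φ(σ) by the defect, and at x = 1/c it bounds the integrand by a
multiple of σ²/φ(σ). -/
theorem entropyDefect_nonneg_and_entropyIntegrand_le (S : EntropySetting ωM φ Ψ) {c : ℝ}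
    (hc : 0 < c) (x : X) : 0 ≤ entropyDefect φ Ψ x ∧
      entropyIntegrand φ Ψ c x ≤ max 0 (c⁻¹ ^ 2 / 2 - c⁻¹) * entropyDefect φ Ψ x := by
  rcases (refDensity_nonneg x).eq_or_lt with h | h
  · rw [entropyIntegrand_of_zero h.symm, entropyDefect, ← h]
    simp [uPhi_zero]
  · have h1 := S.weight.uPhi_mul_le S.rpow_le h (inv_nonneg.2 hc.le)
    have h2 := S.weight.uPhi_mul_le S.rpow_le h zero_le_one
    rw [inv_mul_eq_div] at h1
    rw [one_mul] at h2
    have h3 : 0 ≤ refDensity φ Ψ x ^ 2 / φ (refDensity φ Ψ x) :=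
      div_nonneg (sq_nonneg _) (S.weight.pos _ h).le
    have h4 : refDensity φ Ψ x ^ 2 / φ (refDensity φ Ψ x) ≤ entropyDefect φ Ψ x := by
      rw [entropyDefect]
      linarith
    refine ⟨h3.trans h4, h1.trans ?_⟩
    gcongr
    exact le_max_right _ _

theorem le_entropyIntegrand (S : EntropySetting ωM φ Ψ) {c : ℝ} (hc : 0 < c) (x : X) :
    uPhi φ (refDensity φ Ψ x) - refDensity φ Ψ x * lnPhi φ (refDensity φ Ψ x)
      ≤ entropyIntegrand φ Ψ c x := by
  rcases (refDensity_nonneg x).eq_or_lt with h | h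
  · rw [entropyIntegrand_of_zero h.symm, ← h]
    simp [uPhi_zero]
  · have := S.weight.lnPhi_mul_sub_le S.rpow_le h (div_nonneg h.le hc.le)
    rw [entropyIntegrand]
    linarith

theorem measurable_uPhi_div (S : EntropySetting ωM φ Ψ) {c : ℝ} (hc : 0 < c) :
    Measurable fun x => uPhi φ (refDensity φ Ψ x / c) :=
  S.weight.measurable_uPhi_comp S.rpow_le (S.measurable_refDensity.div_const c)
    fun x => div_nonneg (refDensity_nonneg x) hc.le

theorem integrable_entropyIntegrand (S : EntropySetting ωM φ Ψ) {c : ℝ} (hc : 0 < c) :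
    Integrable (entropyIntegrand φ Ψ c) ωM := by
  refine integrable_of_le_of_le ?_ (Eventually.of_forall fun x => S.le_entropyIntegrand hc x)
    (Eventually.of_forall fun x => (S.entropyDefect_nonneg_and_entropyIntegrand_le hc x).2)
    (S.integrable_uPhi.sub S.integrable_ln) (S.integrable_entropyDefect.const_mul _)
  refine (S.measurable_uPhi_div hc).aestronglyMeasurable.sub ?_
  refine (S.integrable_ln.aestronglyMeasurable.mul_const c⁻¹).congr (Eventually.of_forall ?_)
  intro x
  simp only
  ring

theorem integrable_uPhi_div (S : EntropySetting ωM φ Ψ) {c : ℝ} (hc : 0 < c) :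
    Integrable (fun x => uPhi φ (refDensity φ Ψ x / c)) ωM := by
  refine ((S.integrable_entropyIntegrand hc).add (S.integrable_ln.mul_const c⁻¹)).congr
    (Eventually.of_forall fun x => ?_)
  simp only [entropyIntegrand, Pi.add_apply]
  ring

theorem integrable_hPhi_div (S : EntropySetting ωM φ Ψ) {c : ℝ} (hc : 0 < c) :
    Integrable (fun x => hPhi φ (refDensity φ Ψ x / c)) ωM := by
  by_cases hL : upperLog φ = ⊤
  · simpa [hPhi, hL] using S.integrable_uPhi_div hc
  · simp only [hPhi, hL, if_false]
    exact (S.integrable_uPhi_div hc).sub ((S.integrable_refDensity.div_const c).mul_const _)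

theorem integrable_mul_hPhiDeriv (S : EntropySetting ωM φ Ψ) :
    Integrable (fun x => refDensity φ Ψ x * hPhiDeriv φ (refDensity φ Ψ x)) ωM := by
  refine (S.integrable_ln.sub (S.integrable_refDensity.mul_const
    (if upperLog φ = ⊤ then 0 else (upperLog φ).toReal))).congr (Eventually.of_forall fun x => ?_)
  rcases (refDensity_nonneg (φ := φ) (Ψ := Ψ) x).eq_or_lt with h | h
  · simp [← h]
  · simp only [hPhiDeriv, if_pos h, Pi.sub_apply]
    ring

/-- The entropy of the normalized restriction of the reference measure to a set. -/
theorem relEntropy_cond (S : EntropySetting ωM φ Ψ) [SigmaFinite ωM] {C : Set X}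
    (hC : MeasurableSet C) (hpos : 0 < (refMeasure ωM φ Ψ).real C) :
    relEntropy ωM φ Ψ (ProbabilityTheory.cond (refMeasure ωM φ Ψ) C)
      = ((∫ x in C, entropyIntegrand φ Ψ ((refMeasure ωM φ Ψ).real C) x ∂ωM : ℝ) : EReal) := by
  have := S.isProbabilityMeasure
  set ν := refMeasure ωM φ Ψ with hν
  set c := ν.real C with hc
  have hC0 : ν C ≠ 0 := fun h => hpos.ne' (by simp [hc, Measure.real, h])
  have hm : Measurable ((ν C)⁻¹ • C.indicator fun x => expPhi φ (-Ψ x)) :=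
    (S.measurable_expPhi.indicator hC).const_smul _
  have hden : ProbabilityTheory.cond ν C
      = ωM.withDensity ((ν C)⁻¹ • C.indicator fun x => expPhi φ (-Ψ x)) := by
    rw [withDensity_smul _ (S.measurable_expPhi.indicator hC), withDensity_indicator hC,
      ← restrict_withDensity hC]
    rfl
  have hrn : (fun x => hPhi φ ((ProbabilityTheory.cond ν C).rnDeriv ωM x).toReal)
      =ᵐ[ωM] C.indicator fun x => hPhi φ (refDensity φ Ψ x / c) := by
    have h1 : (ProbabilityTheory.cond ν C).rnDeriv ωM
        =ᵐ[ωM] ((ν C)⁻¹ • C.indicator fun x => expPhi φ (-Ψ x)) := by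
      rw [hden]
      exact Measure.rnDeriv_withDensity ωM hm
    filter_upwards [h1] with x hx
    rw [hx]
    by_cases hxC : x ∈ C
    · simp only [Pi.smul_apply, indicator_of_mem hxC, smul_eq_mul, ENNReal.toReal_mul,
        ENNReal.toReal_inv, refDensity, hc, Measure.real]
      rw [inv_mul_eq_div]
    · simp [indicator_of_notMem hxC, hPhi_zero]
  have hsing : (ProbabilityTheory.cond ν C).singularPart ωM = 0 := by
    refine Measure.singularPart_eq_zero_of_ac ?_
    rw [hden]
    exact withDensity_absolutelyContinuous _ _
  have hint : Integrable (fun x => hPhiDeriv φ (refDensity φ Ψ x)) ν := by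
    rw [hν, refMeasure, integrable_withDensity_iff_integrable_smul' S.measurable_expPhi S.ae_lt_top]
    exact S.integrable_mul_hPhiDeriv
  have h1 : Integrable (fun x => hPhi φ ((ProbabilityTheory.cond ν C).rnDeriv ωM x).toReal) ωM :=
    ((S.integrable_hPhi_div hpos).indicator hC).congr hrn.symm
  have h2 : Integrable (fun x => hPhiDeriv φ (refDensity φ Ψ x)) (ProbabilityTheory.cond ν C) :=
    hint.restrict.smul_measure (ENNReal.inv_ne_top.2 hC0)
  rw [relEntropy, if_pos ⟨h1, h2⟩, hsing, integral_congr_ae hrn, integral_indicator hC,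
    ProbabilityTheory.cond, integral_smul_measure, hν, refMeasure,
    setIntegral_withDensity_eq_setIntegral_toReal_smul S.measurable_expPhi
      (ae_restrict_of_ae S.ae_lt_top) _ hC, smul_eq_mul, ← integral_const_mul,
    ← integral_sub (S.integrable_hPhi_div hpos).integrableOn]
  · simp only [Measure.coe_zero, Pi.zero_apply, EReal.coe_ennreal_zero, mul_zero, add_zero]
    congr 2 with x
    rw [← hPhi_sub_eq_entropyIntegrand, ENNReal.toReal_inv]
    rfl
  · exact (S.integrable_mul_hPhiDeriv.const_mul _).integrableOn

theorem relEntropy_refMeasure (S : EntropySetting ωM φ Ψ) [SigmaFinite ωM] :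
    relEntropy ωM φ Ψ (refMeasure ωM φ Ψ)
      = ((∫ x, entropyIntegrand φ Ψ 1 x ∂ωM : ℝ) : EReal) := by
  have := S.isProbabilityMeasure
  have h := S.relEntropy_cond (C := univ) MeasurableSet.univ (by simp)
  simpa using h

/-- The reference measure minimizes the relative entropy. -/
theorem relEntropy_refMeasure_le (S : EntropySetting ωM φ Ψ) [SigmaFinite ωM] (μ : Measure X)
    [IsProbabilityMeasure μ] :
    relEntropy ωM φ Ψ (refMeasure ωM φ Ψ) ≤ relEntropy ωM φ Ψ μ := by
  rw [S.relEntropy_refMeasure, relEntropy]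
  split_ifs with h
  swap
  · exact le_top
  obtain ⟨h1, h2⟩ := h
  have hdec := Measure.haveLebesgueDecomposition_add μ ωM
  have hfin : ∀ᵐ x ∂ωM, μ.rnDeriv ωM x < ⊤ := Measure.rnDeriv_lt_top μ ωM
  have hmeas := Measure.measurable_rnDeriv μ ωM
  set ρ := μ.rnDeriv ωM with hρ
  set μs := μ.singularPart ωM with hμs
  -- With L_φ = ∞, a nonzero singular part makes the entropy infinite. Otherwise its term in h_φ'(∞)
  -- is zero, and -∫ h_φ'(σ) dμ^s is nonnegative.
  by_cases hcase : upperLog φ = ⊤ ∧ μs univ ≠ 0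
  · rw [hPhiDerivTop, if_pos hcase.1, EReal.top_mul_of_pos, EReal.coe_add_top]
    · exact le_top
    · exact_mod_cast pos_iff_ne_zero.2 hcase.2
  have hzero : hPhiDerivTop φ * ((μs univ : ℝ≥0∞) : EReal) = 0 := by
    rw [hPhiDerivTop]
    split_ifs with hL
    · have : μs univ = 0 := by
        by_contra h'
        exact hcase ⟨hL, h'⟩
      simp [this]
    · simp
  have hsing : ∫ x, hPhiDeriv φ (refDensity φ Ψ x) ∂μs ≤ 0 := by
    by_cases hL : upperLog φ = ⊤
    · have : μs univ = 0 := by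
        by_contra h'
        exact hcase ⟨hL, h'⟩
      rw [Measure.measure_univ_eq_zero.1 this]
      simp
    · exact integral_nonpos fun x => hPhiDeriv_nonpos hL _
  have h2' : Integrable (fun x => hPhiDeriv φ (refDensity φ Ψ x)) (μs + ωM.withDensity ρ) :=
    hdec ▸ h2
  have h3 : Integrable (fun x => (ρ x).toReal • hPhiDeriv φ (refDensity φ Ψ x)) ωM :=
    (integrable_withDensity_iff_integrable_smul' hmeas hfin).1 h2'.right_of_add_measure
  have h4 : ∫ x, hPhiDeriv φ (refDensity φ Ψ x) ∂μ = ∫ x, hPhiDeriv φ (refDensity φ Ψ x) ∂μs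
      + ∫ x, (ρ x).toReal • hPhiDeriv φ (refDensity φ Ψ x) ∂ωM := by
    rw [← integral_withDensity_eq_integral_toReal_smul hmeas hfin,
      ← integral_add_measure h2'.left_of_add_measure h2'.right_of_add_measure, ← hdec]
  rw [hzero, add_zero, EReal.coe_le_coe_iff, h4]
  have h5 : ∫ x, entropyIntegrand φ Ψ 1 x ∂ωM
      ≤ ∫ x, (hPhi φ (ρ x).toReal - (ρ x).toReal • hPhiDeriv φ (refDensity φ Ψ x)) ∂ωM := by
    refine integral_mono_ae (S.integrable_entropyIntegrand one_pos) (h1.sub h3) ?_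
    filter_upwards [S.ae_lowerLog_ne_bot] with x hx
    have := S.weight.hPhi_tangent_le S.rpow_le (refDensity_nonneg x)
      (r := (ρ x).toReal) ENNReal.toReal_nonneg hx
    rw [← hPhi_sub_eq_entropyIntegrand, smul_eq_mul, inv_one, one_mul, div_one]
    linarith
  rw [integral_sub h1 h3] at h5
  linarith

/-! ### Bounds for the entropies of normalized restrictions -/

/-- The constant vanishes for c ≥ 1/2. Smaller c must be allowed because cutting A off by a ball may
push its mass below 1/2; the bound then tends to 0 with the truncation. -/
theorem setIntegral_entropyIntegrand_le (S : EntropySetting ωM φ Ψ) {c : ℝ} (hc : 0 < c)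
    (C : Set X) : ∫ x in C, entropyIntegrand φ Ψ c x ∂ωM
      ≤ max 0 (c⁻¹ ^ 2 / 2 - c⁻¹) * ∫ x, entropyDefect φ Ψ x ∂ωM := by
  calc _ ≤ ∫ x in C, max 0 (c⁻¹ ^ 2 / 2 - c⁻¹) * entropyDefect φ Ψ x ∂ωM :=
        integral_mono (S.integrable_entropyIntegrand hc).integrableOn
          (S.integrable_entropyDefect.const_mul _).integrableOn
          fun x => (S.entropyDefect_nonneg_and_entropyIntegrand_le hc x).2
    _ ≤ ∫ x, max 0 (c⁻¹ ^ 2 / 2 - c⁻¹) * entropyDefect φ Ψ x ∂ωM :=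
        setIntegral_le_integral (S.integrable_entropyDefect.const_mul _)
          (Eventually.of_forall fun x => mul_nonneg (le_max_left _ _)
            (S.entropyDefect_nonneg_and_entropyIntegrand_le hc x).1)
    _ = _ := integral_const_mul _ _

theorem integral_entropyIntegrand_one_nonpos (S : EntropySetting ωM φ Ψ) :
    ∫ x, entropyIntegrand φ Ψ 1 x ∂ωM ≤ 0 := by
  have := S.setIntegral_entropyIntegrand_le one_pos univ
  norm_num at this
  simpa using this

theorem setIntegral_entropyIntegrand_le_of_le_half (S : EntropySetting ωM φ Ψ)
    (hθ : theta φ < ENNReal.ofReal (3 / 2)) {ξ b I : ℝ}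
    (hξ : ∀ᵐ x ∂ωM, refDensity φ Ψ x ≤ ξ) (hb : 0 < b) (hb1 : b ≤ 1) (hbξ : b ≤ ξ) {C : Set X}
    (hI0 : 0 ≤ I)
    (hI : ∫⁻ x in C, ENNReal.ofReal (refDensity φ Ψ x ^ (2 - (theta φ).toReal)) ∂ωM
      ≤ ENNReal.ofReal I) :
    ∫ x in C, entropyIntegrand φ Ψ b x ∂ωM ≤ b ^ ((delta φ).toReal - 2) * -lnPhi φ b
      * ξ ^ ((theta φ).toReal - (delta φ).toReal) * I := by
  have hδ : delta φ ≠ ⊤ := ((delta_le_theta φ).trans_lt hθ).ne_top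
  have hθ' : (theta φ).toReal ≤ 3 / 2 := by
    have := ENNReal.toReal_mono (by simp) hθ.le
    rwa [ENNReal.toReal_ofReal (by norm_num)] at this
  set G := b ^ ((delta φ).toReal - 2) * -lnPhi φ b
      * ξ ^ ((theta φ).toReal - (delta φ).toReal) with hG
  have hG0 : 0 ≤ G := by
    have : lnPhi φ b ≤ 0 := by
      rw [← lnPhi_one (φ := φ)]
      exact S.weight.strictMonoOn_lnPhi.monotoneOn hb (mem_Ioi.2 one_pos) hb1
    have h1 : 0 ≤ -lnPhi φ b := by linarith
    have h2 : 0 < ξ := hb.trans_le hbξ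
    positivity
  have hp0 : ∀ x, 0 ≤ refDensity φ Ψ x ^ (2 - (theta φ).toReal) :=
    fun x => Real.rpow_nonneg (refDensity_nonneg x) _
  have hmeas : Measurable fun x => refDensity φ Ψ x ^ (2 - (theta φ).toReal) :=
    S.measurable_refDensity.pow_const _
  have hint : IntegrableOn (fun x => refDensity φ Ψ x ^ (2 - (theta φ).toReal)) C ωM := by
    refine ⟨hmeas.aestronglyMeasurable, ?_⟩
    rw [hasFiniteIntegral_iff_ofReal (Eventually.of_forall hp0)]
    exact hI.trans_lt ENNReal.ofReal_lt_top
  calc ∫ x in C, entropyIntegrand φ Ψ b x ∂ωM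
      ≤ ∫ x in C, G * refDensity φ Ψ x ^ (2 - (theta φ).toReal) ∂ωM := by
        refine integral_mono_ae (S.integrable_entropyIntegrand hb).integrableOn
          (hint.const_mul G) ?_
        filter_upwards [ae_restrict_of_ae hξ] with x hx
        rcases (refDensity_nonneg (φ := φ) (Ψ := Ψ) x).eq_or_lt with h | h
        · rw [entropyIntegrand_of_zero h.symm]
          exact mul_nonneg hG0 (hp0 x)
        · exact S.weight.uPhi_div_sub_le S.rpow_le hθ.ne_top hδ (delta_le_theta φ) hb hb1 hbξ h hx
    _ = G * ∫ x in C, refDensity φ Ψ x ^ (2 - (theta φ).toReal) ∂ωM := integral_const_mul _ _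
    _ ≤ G * I := by
        refine mul_le_mul_of_nonneg_left ?_ hG0
        rw [integral_eq_lintegral_of_nonneg_ae (Eventually.of_forall hp0)
          hmeas.aestronglyMeasurable]
        exact ENNReal.toReal_le_of_le_ofReal hI0 hI

end EntropySetting

/-! ### The Riemannian volume is σ-finite -/

section Riemannian

variable (n : ℕ) (M : Type*) [MetricSpace M] [ChartedSpace (EuclideanSpace ℝ (Fin n)) M]
  [RiemannianBundle (fun x : M => TangentSpace (𝓡 n) x)] [MeasurableSpace M] [BorelSpace M]

variable {M} in
-- The density in coordinates is finite, so the measure there is σ-finite; its spanning sets are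
-- pulled back through the chart. σ-finiteness of ω underlies the Lebesgue decompositions.
theorem exists_cover_chartVolume_lt_top (c : M) :
    ∃ T : ℕ → Set M, (∀ j, MeasurableSet (T j)) ∧
      (∀ j, T j ⊆ (chartAt (EuclideanSpace ℝ (Fin n)) c).source) ∧
      (chartAt (EuclideanSpace ℝ (Fin n)) c).source ⊆ ⋃ j, T j ∧
      ∀ j, chartVolume n c (T j) < ⊤ := by
  set e := extChartAt (𝓡 n) c with he
  have hsrc : e.source = (chartAt (EuclideanSpace ℝ (Fin n)) c).source := extChartAt_source _ c
  set V := ((volume : Measure (EuclideanSpace ℝ (Fin n))).restrict e.target).withDensity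
    (fun y => ENNReal.ofReal (Real.sqrt (gramMatrix n c y).det)) with hV
  have hσ : SigmaFinite V := inferInstanceAs (SigmaFinite (Measure.withDensity _ _))
  have hVt : V e.targetᶜ = 0 := by
    refine withDensity_absolutelyContinuous _ _ ?_
    rw [Measure.restrict_apply (isOpen_extChartAt_target c).measurableSet.compl,
      compl_inter_self, measure_empty]
  have hms : ∀ j, MeasurableSet (e.source ∩ e ⁻¹' (spanningSets V j)) := fun j => by
    have hm : Measurable (e.source.domRestrict e) :=
      (continuousOn_iff_continuous_domRestrict.1 (continuousOn_extChartAt c)).measurable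
    have := (isOpen_extChartAt_source (I := 𝓡 n) c).measurableSet.subtype_image
      (hm (measurableSet_spanningSets V j))
    convert this using 1
    ext x
    exact ⟨fun h => ⟨⟨x, h.1⟩, h.2, rfl⟩, by rintro ⟨y, hy, rfl⟩; exact ⟨y.2, hy⟩⟩
  refine ⟨fun j => e.source ∩ e ⁻¹' (spanningSets V j), fun j => ?_, fun j => ?_, ?_, fun j => ?_⟩
  · exact hms j
  · rw [hsrc]
    exact inter_subset_left
  · rw [← hsrc, ← inter_iUnion, ← preimage_iUnion, iUnion_spanningSets]
    simp
  · change V.map e.symm _ < ⊤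
    by_cases hm : AEMeasurable e.symm V
    · rw [Measure.map_apply_of_aemeasurable hm (hms j)]
      calc _ ≤ V (spanningSets V j ∪ e.targetᶜ) := by
            refine measure_mono fun y hy => ?_
            by_cases hyt : y ∈ e.target
            · left
              have := hy.2
              rwa [mem_preimage, e.right_inv hyt] at this
            · exact Or.inr hyt
        _ ≤ V (spanningSets V j) + V e.targetᶜ := measure_union_le _ _
        _ < ⊤ := by
            rw [hVt, add_zero]
            exact measure_spanningSets_lt_top V j
    -- The image measure is zero by default in this case.
    · rw [Measure.map_of_not_aemeasurable hm]
      simp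

instance sigmaFinite_riemannianVolume [SecondCountableTopology M] [Nonempty M] :
    SigmaFinite (riemannianVolume n M) := by
  choose T hTm hTs hTc hTf using fun k => exists_cover_chartVolume_lt_top n (chartCenter n M k)
  set src : ℕ → Set M := fun j => (chartAt (EuclideanSpace ℝ (Fin n)) (chartCenter n M j)).source
    with hsrc
  have hDm : ∀ k, MeasurableSet (disjointed src k) := fun k =>
    MeasurableSet.disjointed (fun j => (chartAt _ _).open_source.measurableSet) k
  have hcov : ⋃ k, disjointed src k = univ := by
    rw [iUnion_disjointed]
    exact (exists_chart_cover n M).choose_spec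
  refine Measure.sigmaFinite_of_countable
    (S := range fun p : ℕ × ℕ => disjointed src p.1 ∩ T p.1 p.2) (countable_range _) ?_ ?_
  · rintro _ ⟨⟨k, j⟩, rfl⟩
    have hm := (hDm k).inter (hTm k j)
    rw [riemannianVolume, Measure.sum_apply _ hm, tsum_eq_single k]
    · refine (Measure.restrict_apply_le _ _).trans_lt ?_
      exact (measure_mono inter_subset_right).trans_lt (hTf k j)
    · intro i hi
      rw [Measure.restrict_apply hm]
      have hdis := disjoint_disjointed src hi.symm
      rw [(hdis.mono_left inter_subset_left).inter_eq, measure_empty]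
  · refine eq_univ_of_forall fun x => ?_
    obtain ⟨k, hk⟩ := mem_iUnion.1 (hcov.symm ▸ mem_univ x)
    obtain ⟨j, hj⟩ := mem_iUnion.1 (hTc k (disjointed_subset src k hk))
    exact ⟨_, ⟨(k, j), rfl⟩, hk, hj⟩

theorem sigmaFinite_weightedVolume [SecondCountableTopology M] [Nonempty M] (f : M → ℝ) :
    SigmaFinite (weightedVolume n M f) :=
  inferInstanceAs (SigmaFinite (Measure.withDensity _ _))

end Riemannian

/-! ### Transport between bounded sets -/

section Transport

variable {X : Type*} [MetricSpace X] [MeasurableSpace X]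

theorem memP2_of_ae_mem_ball {μ : Measure X} [IsProbabilityMeasure μ] {x₀ : X} {R : ℝ}
    (h : ∀ᵐ x ∂μ, x ∈ Metric.ball x₀ R) : MemP2 μ := by
  refine ⟨inferInstance, x₀, ?_⟩
  calc ∫⁻ x, edist x₀ x ^ 2 ∂μ ≤ ∫⁻ _, ENNReal.ofReal R ^ 2 ∂μ := by
        refine lintegral_mono_ae ?_
        filter_upwards [h] with x hx
        rw [edist_comm, edist_dist]
        gcongr
        exact (Metric.mem_ball.1 hx).le
    _ < ⊤ := by simp

/-- Every coupling lives on pairs at distance at least r. Boundedness matters because an infinite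
transport cost would become 0 as a real number; the product coupling shows that the infimum is
finite. -/
theorem le_W2 {μ ν : Measure X} [IsProbabilityMeasure μ] [IsProbabilityMeasure ν] {x₀ : X}
    {R r : ℝ} {A B : Set X} (hμR : ∀ᵐ x ∂μ, x ∈ Metric.ball x₀ R)
    (hνR : ∀ᵐ x ∂ν, x ∈ Metric.ball x₀ R) (hμ : ∀ᵐ x ∂μ, x ∈ A) (hν : ∀ᵐ x ∂ν, x ∈ B)
    (hAB : ∀ x ∈ A, ∀ y ∈ B, r ≤ dist x y) : r ≤ W2 μ ν := by
  have hfst : ∀ {γ : Measure (X × X)}, IsCoupling γ μ ν → ∀ {p : X → Prop}, (∀ᵐ x ∂μ, p x) →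
      ∀ᵐ z ∂γ, p z.1 := fun hγ _ hp =>
    ae_of_ae_map measurable_fst.aemeasurable (by rw [hγ.1]; exact hp)
  have hsnd : ∀ {γ : Measure (X × X)}, IsCoupling γ μ ν → ∀ {p : X → Prop}, (∀ᵐ x ∂ν, p x) →
      ∀ᵐ z ∂γ, p z.2 := fun hγ _ hp =>
    ae_of_ae_map measurable_snd.aemeasurable (by rw [hγ.2]; exact hp)
  have huniv : ∀ {γ : Measure (X × X)}, IsCoupling γ μ ν → γ univ = 1 := fun {γ} hγ => by
    rw [← measure_univ (μ := μ), ← hγ.1, Measure.map_apply measurable_fst MeasurableSet.univ,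
      preimage_univ]
  have hsq : ∀ c : ℝ≥0∞, (c ^ 2) ^ (1 / 2 : ℝ) = c := fun c => by
    rw [← ENNReal.rpow_natCast, ← ENNReal.rpow_mul]
    norm_num
  refine (ENNReal.ofReal_le_iff_le_toReal ?_).1 ?_
  · have hprod : IsCoupling (μ.prod ν) μ ν := by
      constructor
      · rw [Measure.map_fst_prod]; simp
      · rw [Measure.map_snd_prod]; simp
    refine ne_top_of_le_ne_top ?_ (iInf₂_le (μ.prod ν) hprod)
    refine ENNReal.rpow_ne_top_of_nonneg (by norm_num) (ne_of_lt ?_)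
    calc ∫⁻ z, edist z.1 z.2 ^ 2 ∂μ.prod ν ≤ ∫⁻ _, ENNReal.ofReal (R + R) ^ 2 ∂μ.prod ν := by
          refine lintegral_mono_ae ?_
          filter_upwards [hfst hprod hμR, hsnd hprod hνR] with z h1 h2
          rw [edist_dist]
          gcongr
          have := dist_triangle_right z.1 z.2 x₀
          have h1 := Metric.mem_ball.1 h1
          have h2 := Metric.mem_ball.1 h2
          linarith
      _ < ⊤ := by simp
  · refine le_iInf₂ fun γ hγ => ?_
    rw [← hsq (ENNReal.ofReal r)]
    refine ENNReal.rpow_le_rpow ?_ (by norm_num)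
    calc ENNReal.ofReal r ^ 2 = ∫⁻ _, ENNReal.ofReal r ^ 2 ∂γ := by simp [huniv hγ]
      _ ≤ _ := by
        refine lintegral_mono_ae ?_
        filter_upwards [hfst hγ hμ, hsnd hγ hν] with z h1 h2
        rw [edist_dist]
        gcongr
        exact hAB _ h1 _ h2

end Transport

/-! ### From displacement convexity to concentration around one set -/

theorem sqrt_mul_le_sqrt_add_sqrt {a b k w : ℝ} (ha : 0 ≤ a) (hb : 0 ≤ b) (hw : 0 ≤ w)
    (h : ∀ t ∈ Icc (0 : ℝ) 1, k * (1 - t) * t * w ^ 2 ≤ (1 - t) * a + t * b) :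
    √k * w ≤ √a + √b := by
  -- The shift by ε > 0 keeps p + q nonzero even when a = b = 0.
  have hc : Tendsto (fun ε => √(a + ε) + √(b + ε)) (𝓝[>] 0) (𝓝 (√a + √b)) := by
    have : Continuous fun ε => √(a + ε) + √(b + ε) := by fun_prop
    simpa using (this.tendsto 0).mono_left nhdsWithin_le_nhds
  refine ge_of_tendsto hc ?_
  filter_upwards [self_mem_nhdsWithin] with ε hε
  have hε : 0 < ε := hε
  have hp : 0 < √(a + ε) := Real.sqrt_pos.2 (by linarith)
  have hq : 0 < √(b + ε) := Real.sqrt_pos.2 (by linarith)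
  have hp2 : √(a + ε) ^ 2 = a + ε := Real.sq_sqrt (by linarith)
  have hq2 : √(b + ε) ^ 2 = b + ε := Real.sq_sqrt (by linarith)
  set p := √(a + ε)
  set q := √(b + ε)
  have hpq : 0 < p + q := by positivity
  -- For this t, (1-t)p² + tq² = pq and t(1-t) = pq/(p+q)², which leaves k w² ≤ (p+q)².
  have h1 := h (p / (p + q)) ⟨by positivity, (div_le_one hpq).2 (by linarith)⟩
  have e : 1 - p / (p + q) = q / (p + q) := by field_simp; ring
  rw [e] at h1
  have h2 : k * w ^ 2 ≤ (p + q) ^ 2 := by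
    have h3 : q / (p + q) * a + p / (p + q) * b ≤ p * q := by
      have : q / (p + q) * a + p / (p + q) * b
          ≤ q / (p + q) * p ^ 2 + p / (p + q) * q ^ 2 := by
        rw [hp2, hq2]
        gcongr <;> linarith
      refine this.trans_eq ?_
      field_simp
    have h4 : k * (q / (p + q)) * (p / (p + q)) * w ^ 2 = k * w ^ 2 * (p * q / (p + q) ^ 2) := by
      field_simp
    rw [h4] at h1
    have h5 := h1.trans h3
    rw [← mul_div_assoc, div_le_iff₀ (by positivity)] at h5
    have : 0 < p * q := by positivity
    nlinarith
  rcases le_or_gt k 0 with hk | hk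
  · rw [Real.sqrt_eq_zero_of_nonpos hk]
    linarith
  · refine (sq_le_sq₀ (by positivity) hpq.le).1 ?_
    rwa [mul_pow, Real.sq_sqrt hk.le]

namespace EntropySetting

variable {X : Type*} [MetricSpace X] [MeasurableSpace X] {ωM : Measure X} {φ : ℝ → ℝ} {Ψ : X → ℝ}

/-- Displacement convexity bounds the distance of two bounded sets by the entropies of the
normalized restrictions of the reference measure. -/
theorem sqrt_mul_le_of_displacementConvexOn (S : EntropySetting ωM φ Ψ) [SigmaFinite ωM] {K : ℝ}
    (hconv : DisplacementConvexOn (relEntropy ωM φ Ψ) (positivitySet φ Ψ) K) {x₀ : X} {R r : ℝ}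
    (hr : 0 ≤ r) {C D : Set X} (hC : MeasurableSet C) (hD : MeasurableSet D)
    (hCR : C ⊆ Metric.ball x₀ R) (hDR : D ⊆ Metric.ball x₀ R)
    (hCpos : 0 < (refMeasure ωM φ Ψ).real C) (hDpos : 0 < (refMeasure ωM φ Ψ).real D)
    (hCD : ∀ x ∈ C, ∀ y ∈ D, r ≤ dist x y) :
    √(K / 2) * r ≤
      √(∫ x in C, entropyIntegrand φ Ψ ((refMeasure ωM φ Ψ).real C) x ∂ωM
          - ∫ x, entropyIntegrand φ Ψ 1 x ∂ωM)
        + √(∫ x in D, entropyIntegrand φ Ψ ((refMeasure ωM φ Ψ).real D) x ∂ωM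
          - ∫ x, entropyIntegrand φ Ψ 1 x ∂ωM) := by
  have := S.isProbabilityMeasure
  have hne : ∀ {B : Set X}, 0 < (refMeasure ωM φ Ψ).real B → refMeasure ωM φ Ψ B ≠ 0 :=
    fun hB h => hB.ne' (by simp [Measure.real, h])
  have hν := S.relEntropy_refMeasure
  have hmin := S.relEntropy_refMeasure_le
  have eC := S.relEntropy_cond hC hCpos
  have eD := S.relEntropy_cond hD hDpos
  have hY := S.refMeasure_compl_positivitySet
  generalize refMeasure ωM φ Ψ = ν at *
  have pC : IsProbabilityMeasure (ProbabilityTheory.cond ν C) :=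
    ProbabilityTheory.cond_isProbabilityMeasure (hne hCpos)
  have pD : IsProbabilityMeasure (ProbabilityTheory.cond ν D) :=
    ProbabilityTheory.cond_isProbabilityMeasure (hne hDpos)
  have mC : ∀ᵐ x ∂(ProbabilityTheory.cond ν C), x ∈ C := ProbabilityTheory.ae_cond_mem hC
  have mD : ∀ᵐ x ∂(ProbabilityTheory.cond ν D), x ∈ D := ProbabilityTheory.ae_cond_mem hD
  have bC := mC.mono fun _ h => hCR h
  have bD := mD.mono fun _ h => hDR h
  have hW : r ≤ W2 (ProbabilityTheory.cond ν C) (ProbabilityTheory.cond ν D) :=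
    le_W2 bC bD mC mD hCD
  obtain ⟨μ, hμ, hcv⟩ := hconv _ _ (memP2_of_ae_mem_ball bC) (memP2_of_ae_mem_ball bD)
    (ProbabilityTheory.cond_absolutelyContinuous hY)
    (ProbabilityTheory.cond_absolutelyContinuous hY)
  set H := ∫ x, entropyIntegrand φ Ψ 1 x ∂ωM
  set a := ∫ x in C, entropyIntegrand φ Ψ (ν.real C) x ∂ωM
  set b := ∫ x in D, entropyIntegrand φ Ψ (ν.real D) x ∂ωM
  set w := W2 (ProbabilityTheory.cond ν C) (ProbabilityTheory.cond ν D)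
  have ha : H ≤ a := by
    have := hmin (ProbabilityTheory.cond ν C)
    rw [hν, eC] at this
    exact_mod_cast this
  have hb : H ≤ b := by
    have := hmin (ProbabilityTheory.cond ν D)
    rw [hν, eD] at this
    exact_mod_cast this
  refine le_trans (mul_le_mul_of_nonneg_left hW (Real.sqrt_nonneg _)) ?_
  refine sqrt_mul_le_sqrt_add_sqrt (sub_nonneg.2 ha) (sub_nonneg.2 hb) (hr.trans hW) ?_
  intro t ht
  have := (hμ.mem t ht).1
  have h1 := (hmin (μ t)).trans (hcv t ht)
  rw [hν, eC, eD] at h1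
  have h2 : H ≤ (1 - t) * a + t * b - K / 2 * (1 - t) * t * w ^ 2 := by exact_mod_cast h1
  linarith

theorem tendsto_real_inter_ball {ν : Measure X} [IsFiniteMeasure ν] (x₀ : X) (C : Set X) :
    Tendsto (fun N : ℕ => ν.real (C ∩ Metric.ball x₀ N)) atTop (𝓝 (ν.real C)) := by
  have h : Tendsto (fun N : ℕ => ν (C ∩ Metric.ball x₀ N)) atTop (𝓝 (ν C)) := by
    have hmono : Monotone fun N : ℕ => C ∩ Metric.ball x₀ (N : ℝ) := fun i j hij =>
      inter_subset_inter_right _ (Metric.ball_subset_ball (by exact_mod_cast hij))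
    have := tendsto_measure_iUnion_atTop (μ := ν) hmono
    rwa [← inter_iUnion, Metric.iUnion_ball_nat, inter_univ] at this
  exact (ENNReal.tendsto_toReal (measure_ne_top ν C)).comp h

variable [BorelSpace X]

/-- The concentration estimate for a single set of mass at least `1 / 2`. -/
theorem sqrt_mul_le_of_half_le (S : EntropySetting ωM φ Ψ) [SigmaFinite ωM] {K : ℝ}
    (hconv : DisplacementConvexOn (relEntropy ωM φ Ψ) (positivitySet φ Ψ) K)
    (hθ : theta φ < ENNReal.ofReal (3 / 2)) {r ξ I : ℝ} (hr : 0 ≤ r)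
    (hξ : ∀ᵐ x ∂ωM, refDensity φ Ψ x ≤ ξ) (hξ2 : 1 / 2 ≤ ξ) {A : Set X} (hA : MeasurableSet A)
    (hA2 : 1 / 2 ≤ (refMeasure ωM φ Ψ).real A)
    (hpos : 0 < (refMeasure ωM φ Ψ).real (Metric.thickening r A)ᶜ)
    (hhalf : (refMeasure ωM φ Ψ).real (Metric.thickening r A)ᶜ ≤ 1 / 2) (hI0 : 0 ≤ I)
    (hI : ∫⁻ x in (Metric.thickening r A)ᶜ,
      ENNReal.ofReal (refDensity φ Ψ x ^ (2 - (theta φ).toReal)) ∂ωM ≤ ENNReal.ofReal I) :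
    √(K / 2) * r ≤ √(-∫ x, entropyIntegrand φ Ψ 1 x ∂ωM) +
      √((refMeasure ωM φ Ψ).real (Metric.thickening r A)ᶜ ^ ((delta φ).toReal - 2)
          * -lnPhi φ ((refMeasure ωM φ Ψ).real (Metric.thickening r A)ᶜ)
          * ξ ^ ((theta φ).toReal - (delta φ).toReal) * I
        - ∫ x, entropyIntegrand φ Ψ 1 x ∂ωM) := by
  have := S.isProbabilityMeasure
  set B := (Metric.thickening r A)ᶜ with hB
  have hBm : MeasurableSet B := Metric.isOpen_thickening.measurableSet.compl
  set ν := refMeasure ωM φ Ψ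
  set H := ∫ x, entropyIntegrand φ Ψ 1 x ∂ωM with hH
  set Q := ∫ x, entropyDefect φ Ψ x ∂ωM
  obtain ⟨x₀⟩ : Nonempty X := by
    by_contra h
    rw [not_nonempty_iff] at h
    simp [Measure.real, eq_empty_of_isEmpty B] at hpos
  have hApos : 0 < ν.real A := by linarith
  have tA := tendsto_real_inter_ball (ν := ν) x₀ A
  have tB := tendsto_real_inter_ball (ν := ν) x₀ B
  -- The positive part is continuous in the mass and is 0 at ν[A] ≥ 1/2, so the truncated entropies
  -- of A contribute at most 0 in the limit.
  have lA : Tendsto (fun a : ℝ => √(max 0 (a⁻¹ ^ 2 / 2 - a⁻¹) * Q - H)) (𝓝 (ν.real A))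
      (𝓝 (√(-H))) := by
    have hc : ContinuousAt (fun a : ℝ => √(max 0 (a⁻¹ ^ 2 / 2 - a⁻¹) * Q - H)) (ν.real A) := by
      fun_prop (disch := exact hApos.ne')
    have e : max 0 ((ν.real A)⁻¹ ^ 2 / 2 - (ν.real A)⁻¹) = 0 := by
      refine max_eq_left ?_
      have h0 : 0 < (ν.real A)⁻¹ := inv_pos.2 hApos
      have h2 : (ν.real A)⁻¹ ≤ 2 := by
        rw [inv_le_comm₀ hApos two_pos]
        linarith
      nlinarith
    have := hc.tendsto
    rwa [e, zero_mul, zero_sub] at this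
  have lB : ContinuousAt (fun b : ℝ => √(b ^ ((delta φ).toReal - 2) * -lnPhi φ b
      * ξ ^ ((theta φ).toReal - (delta φ).toReal) * I - H)) (ν.real B) := by
    refine Real.continuous_sqrt.continuousAt.comp (ContinuousAt.sub ?_ continuousAt_const)
    refine ((ContinuousAt.mul ?_ ?_).mul continuousAt_const).mul continuousAt_const
    · exact Real.continuousAt_rpow_const _ _ (Or.inl hpos.ne')
    · exact (S.weight.hasDerivAt_lnPhi hpos).continuousAt.neg
  refine ge_of_tendsto ((lA.comp tA).add (lB.tendsto.comp tB)) ?_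
  filter_upwards [tA.eventually_const_lt hApos, tB.eventually_const_lt hpos] with N hAN hBN
  refine (S.sqrt_mul_le_of_displacementConvexOn hconv hr (hA.inter measurableSet_ball)
    (hBm.inter measurableSet_ball) inter_subset_right inter_subset_right hAN hBN ?_).trans ?_
  · intro x hx y hy
    by_contra! h
    rw [dist_comm] at h
    exact hy.1 (Metric.mem_thickening_iff.2 ⟨x, hx.1, h⟩)
  · have hle : ν.real (B ∩ Metric.ball x₀ N) ≤ 1 / 2 :=
      (measureReal_mono inter_subset_left).trans hhalf
    refine add_le_add (Real.sqrt_le_sqrt ?_) (Real.sqrt_le_sqrt ?_)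
    · exact sub_le_sub_right (S.setIntegral_entropyIntegrand_le hAN _) _
    · refine sub_le_sub_right ?_ _
      refine S.setIntegral_entropyIntegrand_le_of_le_half hθ hξ hBN (by linarith) (by linarith) hI0
        ((lintegral_mono_set inter_subset_left).trans hI)

end EntropySetting

/-! ### The concentration function -/

section Concentration

variable {X : Type*} [MetricSpace X] [MeasurableSpace X]

theorem bddAbove_concentration_set (ν : Measure X) (r : ℝ) :
    BddAbove {a : ℝ | ∃ A : Set X, MeasurableSet A ∧ 1 / 2 ≤ ν.real A ∧
      a = 1 - ν.real (Metric.thickening r A)} := by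
  refine ⟨1, ?_⟩
  rintro _ ⟨A, -, -, rfl⟩
  linarith [measureReal_nonneg (μ := ν) (s := Metric.thickening r A)]

theorem nonempty_concentration_set (ν : Measure X) [IsProbabilityMeasure ν] (r : ℝ) :
    {a : ℝ | ∃ A : Set X, MeasurableSet A ∧ 1 / 2 ≤ ν.real A ∧
      a = 1 - ν.real (Metric.thickening r A)}.Nonempty :=
  ⟨_, univ, MeasurableSet.univ, by simp; norm_num, rfl⟩

theorem one_sub_measureReal_thickening_le_half {ν : Measure X} [IsProbabilityMeasure ν] {r : ℝ}
    (hr : 0 < r) {A : Set X} (hA : 1 / 2 ≤ ν.real A) :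
    1 - ν.real (Metric.thickening r A) ≤ 1 / 2 := by
  linarith [measureReal_mono (μ := ν) (Metric.self_subset_thickening hr A)]

theorem concentration_le_half {ν : Measure X} [IsProbabilityMeasure ν] {r : ℝ} (hr : 0 < r) :
    concentration ν r ≤ 1 / 2 := by
  refine csSup_le (nonempty_concentration_set ν r) ?_
  rintro _ ⟨A, -, hA, rfl⟩
  exact one_sub_measureReal_thickening_le_half hr hA

/-- The concentration estimate when the supremum of the integrals is finite. -/
theorem EntropySetting.sqrt_mul_le_concentration [BorelSpace X] {ωM : Measure X} {φ : ℝ → ℝ} {Ψ : X → ℝ}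
    (S : EntropySetting ωM φ Ψ) [SigmaFinite ωM] {K : ℝ}
    (hconv : DisplacementConvexOn (relEntropy ωM φ Ψ) (positivitySet φ Ψ) K)
    (hθ : theta φ < ENNReal.ofReal (3 / 2)) {r ξ I : ℝ} (hr : 0 < r)
    (hξ : ∀ᵐ x ∂ωM, refDensity φ Ψ x ≤ ξ) (hξ2 : 1 / 2 ≤ ξ)
    (hpos : 0 < concentration (refMeasure ωM φ Ψ) r) (hI0 : 0 ≤ I)
    (hI : ∀ A : Set X, MeasurableSet A → 1 / 2 ≤ (refMeasure ωM φ Ψ).real A →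
      ∫⁻ x in (Metric.thickening r A)ᶜ,
        ENNReal.ofReal (refDensity φ Ψ x ^ (2 - (theta φ).toReal)) ∂ωM ≤ ENNReal.ofReal I) :
    √(K / 2) * r ≤ √(-∫ x, entropyIntegrand φ Ψ 1 x ∂ωM) +
      √(concentration (refMeasure ωM φ Ψ) r ^ ((delta φ).toReal - 2)
          * -lnPhi φ (concentration (refMeasure ωM φ Ψ) r)
          * ξ ^ ((theta φ).toReal - (delta φ).toReal) * I
        - ∫ x, entropyIntegrand φ Ψ 1 x ∂ωM) := by
  have := S.isProbabilityMeasure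
  obtain ⟨u, -, hu, hmem⟩ := exists_seq_tendsto_sSup
    (nonempty_concentration_set (refMeasure ωM φ Ψ) r)
    (bddAbove_concentration_set (refMeasure ωM φ Ψ) r)
  change Tendsto u atTop (𝓝 (concentration (refMeasure ωM φ Ψ) r)) at hu
  have hc : ContinuousAt (fun b : ℝ => √(-∫ x, entropyIntegrand φ Ψ 1 x ∂ωM) +
      √(b ^ ((delta φ).toReal - 2) * -lnPhi φ b
      * ξ ^ ((theta φ).toReal - (delta φ).toReal) * I - ∫ x, entropyIntegrand φ Ψ 1 x ∂ωM))
      (concentration (refMeasure ωM φ Ψ) r) := by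
    refine continuousAt_const.add ?_
    refine Real.continuous_sqrt.continuousAt.comp (ContinuousAt.sub ?_ continuousAt_const)
    refine ((ContinuousAt.mul ?_ ?_).mul continuousAt_const).mul continuousAt_const
    · exact Real.continuousAt_rpow_const _ _ (Or.inl hpos.ne')
    · exact (S.weight.hasDerivAt_lnPhi hpos).continuousAt.neg
  -- The same I serves every set of the sequence, so only the coefficient in b varies, and it is
  -- continuous at the positive limit.
  refine ge_of_tendsto (hc.tendsto.comp hu) ?_
  filter_upwards [hu.eventually_const_lt hpos] with N hN
  obtain ⟨A, hA, hA2, hAu⟩ := hmem N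
  have hcompl : (refMeasure ωM φ Ψ).real (Metric.thickening r A)ᶜ = u N := by
    rw [hAu, probReal_compl_eq_one_sub Metric.isOpen_thickening.measurableSet]
  have hhalf : u N ≤ 1 / 2 := hAu ▸ one_sub_measureReal_thickening_le_half hr hA2
  have := S.sqrt_mul_le_of_half_le hconv hθ hr.le hξ hξ2 hA hA2 (hcompl ▸ hN) (hcompl ▸ hhalf) hI0
    (hI A hA hA2)
  rwa [hcompl] at this

end Concentration

/-! ### Final algebra and the main theorem -/

theorem neg_le_of_le_sqrt_add_sqrt {x H G : ℝ} (hx : 0 ≤ x) (hH : H ≤ 0) (hG : 0 ≤ G)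
    (h : x ≤ √(-H) + √(G - H)) : -G ≤ -(x - √(-H)) ^ 2 - H := by
  have h1 : √(-H) ^ 2 = -H := Real.sq_sqrt (by linarith)
  have h2 : √(G - H) ^ 2 = G - H := Real.sq_sqrt (by linarith)
  have h3 := Real.sqrt_nonneg (-H)
  have h4 := Real.sqrt_nonneg (G - H)
  -- Above √(-H) the hypothesis can be squared; below it, 0 ≤ x gives (x - √(-H))² ≤ -H ≤ G - H.
  rcases le_total √(-H) x with h5 | h5
  · nlinarith
  · nlinarith

end PhiEntropy

theorem proposition7p4 (n : ℕ) (hn : 2 ≤ n)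
    {M : Type*} [MetricSpace M] [CompleteSpace M] [ConnectedSpace M] [SecondCountableTopology M]
    [MeasurableSpace M] [BorelSpace M]
    [ChartedSpace (EuclideanSpace ℝ (Fin n)) M] [IsManifold (𝓡 n) ∞ M]
    [RiemannianBundle (fun x : M => TangentSpace (𝓡 n) x)]
    [IsContMDiffRiemannianBundle (𝓡 n) ∞ (EuclideanSpace ℝ (Fin n))
      (fun x : M => TangentSpace (𝓡 n) x)]
    [IsRiemannianManifold (𝓡 n) M]
    (f : M → ℝ) (hf : ContMDiff (𝓡 n) 𝓘(ℝ) ∞ f)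
    (ωM : Measure M) (hω : ωM = PhiEntropy.weightedVolume n M f)
    (φ : ℝ → ℝ) (hφ : PhiEntropy.IsWeightFunction φ)
    (Ψ : M → ℝ) (hΨ : Continuous Ψ)
    (hadm : PhiEntropy.Admissible n ωM φ Ψ)
    (σ : M → ℝ) (hσ : σ = PhiEntropy.refDensity φ Ψ)
    (ν : Measure M) (hν : ν = PhiEntropy.refMeasure ωM φ Ψ) [IsProbabilityMeasure ν]
    (K : ℝ) (hK : 0 < K)
    (hconv : PhiEntropy.DisplacementConvexOn (PhiEntropy.relEntropy ωM φ Ψ)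
      (PhiEntropy.positivitySet φ Ψ) K)
    (hbdd : eLpNorm σ ⊤ ωM < ⊤)
    (θ δ : ℝ) (hθ : θ = (PhiEntropy.theta φ).toReal) (hδ : δ = (PhiEntropy.delta φ).toReal) :
    ∃ Hν : ℝ, PhiEntropy.relEntropy ωM φ Ψ ν = (Hν : EReal) ∧ Hν ≤ 0 ∧
      ∀ ξ₀ : ℝ, max (1 / 2) (eLpNorm σ ⊤ ωM).toReal ≤ ξ₀ →
        ∀ r : ℝ, 0 < r → 0 < PhiEntropy.concentration ν r →
          ((PhiEntropy.concentration ν r ^ (δ - 2)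
                * PhiEntropy.lnPhi φ (PhiEntropy.concentration ν r)
                * ξ₀ ^ (θ - δ) : ℝ) : EReal)
              * ((⨆ A : Set M, ⨆ _ : MeasurableSet A ∧ 1 / 2 ≤ ν.real A,
                  ∫⁻ x in (Metric.thickening r A)ᶜ, ENNReal.ofReal (σ x ^ (2 - θ)) ∂ωM : ℝ≥0∞) :
                  EReal)
            ≤ ((-(√(K / 2) * r - √(-Hν)) ^ 2 - Hν : ℝ) : EReal) := by
  have hωσ : SigmaFinite ωM := hω ▸ PhiEntropy.sigmaFinite_weightedVolume n M f
  have S : PhiEntropy.EntropySetting ωM φ Ψ :=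
    { weight := hφ
      rpow_le := fun s hs hs1 => hφ.rpow_le hadm.normalized hadm.theta_lt hs hs1
      measurable_potential := hΨ.measurable
      isProbabilityMeasure := hν ▸ inferInstance
      integrable_h := hadm.integrable_h
      integrable_ln := hadm.integrable_ln }
  subst hσ hν hθ hδ
  have hH0 := S.integral_entropyIntegrand_one_nonpos
  refine ⟨_, S.relEntropy_refMeasure, hH0, fun ξ hξ r hr hα => ?_⟩
  have hα2 := PhiEntropy.concentration_le_half (ν := PhiEntropy.refMeasure ωM φ Ψ) hr
  have hξ2 : 1 / 2 ≤ ξ := (le_max_left _ _).trans hξ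
  have hξ0 : 0 < ξ := by linarith
  have hσξ : ∀ᵐ x ∂ωM, PhiEntropy.refDensity φ Ψ x ≤ ξ := by
    rw [eLpNorm_exponent_top] at hξ hbdd
    filter_upwards [ae_le_eLpNormEssSup (f := PhiEntropy.refDensity φ Ψ) (μ := ωM)] with x hx
    refine le_trans ?_ ((le_max_right _ _).trans hξ)
    rw [← ENNReal.ofReal_le_iff_le_toReal hbdd.ne]
    rwa [Real.enorm_eq_ofReal (PhiEntropy.refDensity_nonneg x)] at hx
  have key := fun I => S.sqrt_mul_le_concentration (I := I) hconv hadm.theta_lt hr hσξ hξ2 hα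
  generalize PhiEntropy.concentration (PhiEntropy.refMeasure ωM φ Ψ) r = α at *
  have hln : PhiEntropy.lnPhi φ α < 0 := by
    rw [← PhiEntropy.lnPhi_one (φ := φ)]
    exact hφ.strictMonoOn_lnPhi hα (mem_Ioi.2 one_pos) (by linarith)
  have hα0 : 0 < α ^ ((PhiEntropy.delta φ).toReal - 2) := by positivity
  have hξp : 0 < ξ ^ ((PhiEntropy.theta φ).toReal - (PhiEntropy.delta φ).toReal) := by positivity
  have hcoef : α ^ ((PhiEntropy.delta φ).toReal - 2) * PhiEntropy.lnPhi φ α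
      * ξ ^ ((PhiEntropy.theta φ).toReal - (PhiEntropy.delta φ).toReal) < 0 :=
    mul_neg_of_neg_of_pos (mul_neg_of_pos_of_neg hα0 hln) hξp
  have hle : ∀ A : Set M, MeasurableSet A → 1 / 2 ≤ (PhiEntropy.refMeasure ωM φ Ψ).real A → _ ≤ _ :=
    fun A hA hA2 => le_iSup₂ (f := fun (A : Set M)
      (_ : MeasurableSet A ∧ 1 / 2 ≤ (PhiEntropy.refMeasure ωM φ Ψ).real A) =>
        ∫⁻ x in (Metric.thickening r A)ᶜ, ENNReal.ofReal
          (PhiEntropy.refDensity φ Ψ x ^ (2 - (PhiEntropy.theta φ).toReal)) ∂ωM) A ⟨hA, hA2⟩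
  generalize (⨆ A : Set M, ⨆ _ : MeasurableSet A ∧ 1 / 2 ≤ (PhiEntropy.refMeasure ωM φ Ψ).real A,
    ∫⁻ x in (Metric.thickening r A)ᶜ, ENNReal.ofReal
      (PhiEntropy.refDensity φ Ψ x ^ (2 - (PhiEntropy.theta φ).toReal)) ∂ωM) = s at *
  -- The coefficient is negative because α ≤ 1/2 < 1, so an infinite supremum makes the left side
  -- -∞.
  rcases eq_or_ne s ⊤ with rfl | hs
  · rw [EReal.coe_ennreal_top, EReal.coe_mul_top_of_neg hcoef]
    exact bot_le
  · have hk := key s.toReal ENNReal.toReal_nonneg (by rwa [ENNReal.ofReal_toReal hs])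
    have hfin := PhiEntropy.neg_le_of_le_sqrt_add_sqrt (by positivity) hH0
      (mul_nonneg (mul_nonneg (mul_nonneg hα0.le (neg_nonneg.2 hln.le)) hξp.le)
        ENNReal.toReal_nonneg) hk
    rw [← EReal.coe_ennreal_toReal hs, ← EReal.coe_mul, EReal.coe_le_coe_iff]
    refine le_trans (le_of_eq ?_) hfin
    ring
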